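/- Let $\Omega$ be a locally compact Hausdorff space with countable base, and let $\mathcal M^+(\Omega)$ be the class of nonnegative Radon (locally finite Borel) measures on $\Omega$. A kernel is a lower semicontinuous function $G:\Omega\times\Omega\to(0,+\infty]$, and $\mathbf G\nu(x)=\int_\Omega G(x,y)\,d\nu(y)$ is the potential of $\nu$. A kernel is quasi-metric with constant $\kappa>0$ if it is symmetric and $d=1/G$ satisfies $d(x,y)\le\kappa\,[d(x,z)+d(z,y)]$ for all $x,y,z\in\Omega$. A kernel $G$ is quasi-metrically modifiable with modifier $m$, where $m$ is a positive continuous function on $\Omega$, if $$\widetilde G(x,y)=\frac{G(x,y)}{m(x)\,m(y)}$$ is quasi-metric, with some constant $\tilde\kappa$. For $0<q<1$ and $\sigma\in\mathcal M^+(\Omega)$, put $d\tilde\sigma=m^{1+q}\,d\sigma$ and $\widetilde B(x,r)=\{y\in\Omega:\widetilde G(x,y)>1/r\}$ for $r>0$. For a Borel set $E\subseteq\Omega$ let $\tilde\varkappa(E)\in[0,+\infty]$ be the least constant in the inequality $$\|\widetilde{\mathbf G}\nu\|_{L^q(\Omega,\tilde\sigma_E)}\le\tilde\varkappa(E)\,\nu(\Omega)\qquad\text{for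 all }\nu\in\mathcal M^+(\Omega),$$ where $\tilde\sigma_E$ is the restriction of $\tilde\sigma$ to $E$, and let $$\widetilde{\mathbf K}\sigma(x)=\int_0^\infty\frac{[\tilde\varkappa(\widetilde B(x,r))]^{\frac q{1-q}}}{r^2}\,dr .$$ Let also $\mu\in\mathcal M^+(\Omega)$, and consider the equation $$u=\mathbf G(u^q\,d\sigma)+\mathbf G\mu\qquad d\sigma\text{-a.e. in }\Omega. \tag{1}$$ A Borel measurable $u:\Omega\to[0,+\infty]$ is a nontrivial supersolution of (1) if $u>0$ and $\mathbf G(u^q\,d\sigma)+\mathbf G\mu\le u<+\infty$ $d\sigma$-a.e.; it is a subsolution if $u\le\mathbf G(u^q\,d\sigma)+\mathbf G\mu<+\infty$ $d\sigma$-a.e.; it is a nontrivial solution if it is both a subsolution and a nontrivial supersolution. **Theorem 1.2.** Let $0<q<1$ and $\tilde\kappa>0$. There are positive constants $c,C$, depending only on $q$ and $\tilde\kappa$, such that the following holds for every $\Omega$ as above, all $\mu,\sigma\in\mathcal M^+(\Omega)$ with $\sigma\ne0$, and every kernel $G$ on $\Omega\times\Omega$ that is quasi-metrically modifiable with a modifier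 $m$ such that $\widetilde G$ has quasi-metric constant $\tilde\kappa$. Any nontrivial solution $u$ of (1) is unique (any two nontrivial solutions coincide $d\sigma$-a.e.) and satisfies, $d\sigma$-a.e. in $\Omega$, the bilateral pointwise estimates $$c\,m\left(\left[\frac{\mathbf G(m^q\,d\sigma)}{m}\right]^{\frac1{1-q}}+\widetilde{\mathbf K}\sigma\right)+\mathbf G\mu\;\le\;u \tag{2}$$ and $$u\;\le\;C\,m\left(\left[\frac{\mathbf G(m^q\,d\sigma)}{m}\right]^{\frac1{1-q}}+\widetilde{\mathbf K}\sigma\right)+C\,\mathbf G\mu. \tag{3}$$ The lower bound (2) holds $d\sigma$-a.e. for every nontrivial supersolution $u$ of (1), and the upper bound (3) holds $d\sigma$-a.e. for every subsolution $u$ of (1). -/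

import Mathlib

open MeasureTheory
open scoped ENNReal NNReal

noncomputable section

namespace SublinearKernel

/-- A kernel on `Ω × Ω`: a strictly positive, possibly infinite, lower semicontinuous function. -/
structure IsKernel {Ω : Type*} [TopologicalSpace Ω] (G : Ω → Ω → ℝ≥0∞) : Prop where
  pos : ∀ x y, 0 < G x y
  lsc : LowerSemicontinuous (fun p : Ω × Ω => G p.1 p.2)

/-- `G` is quasi-metric with constant `κ`: it is symmetric, and `d = 1 / G` satisfies the
quasi-triangle inequality with constant `κ`. -/
structure IsQuasiMetric {Ω : Type*} (G : Ω → Ω → ℝ≥0∞) (κ : ℝ≥0) : Prop where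
  symm : ∀ x y, G x y = G y x
  quasi_triangle : ∀ x y z, (G x y)⁻¹ ≤ κ * ((G x z)⁻¹ + (G z y)⁻¹)

/-- The modified kernel `G(x, y) / (m(x) m(y))`. -/
def modKernel {Ω : Type*} (G : Ω → Ω → ℝ≥0∞) (m : Ω → ℝ≥0) (x y : Ω) : ℝ≥0∞ :=
  G x y / ((m x : ℝ≥0∞) * (m y : ℝ≥0∞))

/-- The kernel `G` is quasi-metrically modifiable with modifier `m`, where `κ` is the
quasi-metric constant of the modified kernel. -/
structure IsQuasiMetricallyModifiable {Ω : Type*} [TopologicalSpace Ω]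
    (G : Ω → Ω → ℝ≥0∞) (m : Ω → ℝ≥0) (κ : ℝ≥0) : Prop where
  continuous : Continuous m
  pos : ∀ x, 0 < m x
  quasiMetric : IsQuasiMetric (modKernel G m) κ

/-- The potential `Gν(x) = ∫ G(x, y) dν(y)`. -/
def potential {Ω : Type*} [MeasurableSpace Ω] (G : Ω → Ω → ℝ≥0∞) (ν : Measure Ω) (x : Ω) :
    ℝ≥0∞ :=
  ∫⁻ y, G x y ∂ν

/-- The ball `B(x, r) = {y : G(x, y) > 1 / r}`, for `r > 0`. -/
def ball {Ω : Type*} (G : Ω → Ω → ℝ≥0∞) (x : Ω) (r : ℝ) : Set Ω :=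
  {y | ENNReal.ofReal (1 / r) < G x y}

/-- The least constant `C ∈ [0, ∞]` in the inequality `‖Gν‖_{L^q(σ_E)} ≤ C ν(Ω)` for all
nonnegative Radon (i.e. locally finite Borel) measures `ν`, where `σ_E` is `σ` restricted to
`E`. -/
def leastConst {Ω : Type*} [TopologicalSpace Ω] [MeasurableSpace Ω] (G : Ω → Ω → ℝ≥0∞) (q : ℝ)
    (σ : Measure Ω) (E : Set Ω) : ℝ≥0∞ :=
  sInf {C : ℝ≥0∞ | ∀ ν : Measure Ω, IsLocallyFiniteMeasure ν →
    (∫⁻ x, potential G ν x ^ q ∂(σ.restrict E)) ^ (1 / q) ≤ C * ν Set.univ}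

/-- The intrinsic nonlinear potential
`Kσ(x) = ∫₀^∞ [ϰ(B(x, r), σ)]^{q/(1-q)} r⁻² dr` of the kernel `G`. -/
def intrinsicPotential {Ω : Type*} [TopologicalSpace Ω] [MeasurableSpace Ω]
    (G : Ω → Ω → ℝ≥0∞) (q : ℝ) (σ : Measure Ω) (x : Ω) : ℝ≥0∞ :=
  ∫⁻ r in Set.Ioi (0 : ℝ),
    leastConst G q σ (ball G x r) ^ (q / (1 - q)) / ENNReal.ofReal (r ^ 2)

/-- The measure `m^s dσ`. -/
def powMeasure {Ω : Type*} [MeasurableSpace Ω] (m : Ω → ℝ≥0) (s : ℝ) (σ : Measure Ω) :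
    Measure Ω :=
  σ.withDensity (fun y => (m y : ℝ≥0∞) ^ s)

/-- The modified intrinsic potential: the intrinsic potential of the modified kernel and of the
measure `m^{1+q} dσ`. -/
def modIntrinsicPotential {Ω : Type*} [TopologicalSpace Ω] [MeasurableSpace Ω]
    (G : Ω → Ω → ℝ≥0∞) (m : Ω → ℝ≥0) (q : ℝ) (σ : Measure Ω) (x : Ω) : ℝ≥0∞ :=
  intrinsicPotential (modKernel G m) q (powMeasure m (1 + q) σ) x

/-- The right-hand side `G(u^q dσ) + Gμ` of the sublinear integral equation. -/
def sublinearMap {Ω : Type*} [MeasurableSpace Ω] (G : Ω → Ω → ℝ≥0∞) (q : ℝ) (σ μ : Measure Ω)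
    (u : Ω → ℝ≥0∞) (x : Ω) : ℝ≥0∞ :=
  potential G (σ.withDensity (fun y => u y ^ q)) x + potential G μ x

/-- Nontrivial supersolutions: `u > 0` and `G(u^q dσ) + Gμ ≤ u < ∞`, `σ`-a.e. -/
structure IsNontrivialSupersolution {Ω : Type*} [MeasurableSpace Ω] (G : Ω → Ω → ℝ≥0∞) (q : ℝ)
    (σ μ : Measure Ω) (u : Ω → ℝ≥0∞) : Prop where
  measurable : Measurable u
  pos : ∀ᵐ x ∂σ, 0 < u x
  le : ∀ᵐ x ∂σ, sublinearMap G q σ μ u x ≤ u x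
  lt_top : ∀ᵐ x ∂σ, u x < ∞

/-- Subsolutions: `u ≤ G(u^q dσ) + Gμ < ∞`, `σ`-a.e. -/
structure IsSubsolution {Ω : Type*} [MeasurableSpace Ω] (G : Ω → Ω → ℝ≥0∞) (q : ℝ)
    (σ μ : Measure Ω) (u : Ω → ℝ≥0∞) : Prop where
  measurable : Measurable u
  le : ∀ᵐ x ∂σ, u x ≤ sublinearMap G q σ μ u x
  lt_top : ∀ᵐ x ∂σ, sublinearMap G q σ μ u x < ∞

/-- Nontrivial solutions of `u = G(u^q dσ) + Gμ`, understood `σ`-a.e. -/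
def IsNontrivialSolution {Ω : Type*} [MeasurableSpace Ω] (G : Ω → Ω → ℝ≥0∞) (q : ℝ)
    (σ μ : Measure Ω) (u : Ω → ℝ≥0∞) : Prop :=
  IsSubsolution G q σ μ u ∧ IsNontrivialSupersolution G q σ μ u

/-- The function `m ([G(m^q dσ) / m]^{1/(1-q)} + K̃σ)` that governs the bilateral estimates. -/
def modBound {Ω : Type*} [TopologicalSpace Ω] [MeasurableSpace Ω]
    (G : Ω → Ω → ℝ≥0∞) (m : Ω → ℝ≥0) (q : ℝ) (σ : Measure Ω) (x : Ω) : ℝ≥0∞ :=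
  (m x : ℝ≥0∞) * ((potential G (powMeasure m q σ) x / (m x : ℝ≥0∞)) ^ (1 / (1 - q))
    + modIntrinsicPotential G m q σ x)

end SublinearKernel

end

open SublinearKernel

noncomputable section

namespace SublinearKernel

/-! Dividing by the modifier reduces everything to a quasi-metric kernel: if `u` is a sub- or
supersolution for `(G, σ, μ)`, then `u / m` is one for the modified kernel, the measure `m^(1+q) dσ`
and the datum `m dμ`. For a quasi-metric kernel put `ω = u^q dσ`; the point is to compare `Gω` with
`(Gσ)^(1/(1-q)) + Kσ`.

Lower bound, using `Gω ≤ u`. A Vitali covering argument gives a weak-type (1,1) bound for `Gν / Gω`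
with respect to `ω` (`IsQuasiMetric.mul_measure_potential_lt_le`). On a set of finite `ω`-measure,
weak type implies an `L^q` bound, hence `ϰ(E)^(q/(1-q)) ≲ ω(E)`; integrating over balls gives `Kσ ≲
Gω`. The bound for `Gσ` comes from a rearrangement along the level sets of `G(x, ·)`
(`IsQuasiMetric.potential_le_rpow`).

Upper bound, using `u ≤ Gω + Gμ`. On a ball about `x`, the potentials split into a near part,
controlled by `ϰ` of the ball, and a far part, controlled by the values at `x`. Integration over
radii and Hölder's inequality give `X ≤ S (X^q + M^q)` with `X = Gω(x)`, `M = Gμ(x)` and `S`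
comparable to `Kσ(x)^(1-q) + Gσ(x)`. Since `X` is finite and `q < 1`, this can be solved for `X`.

Uniqueness. Both bounds involve the same function, so a subsolution `u` satisfies `u ≤ A v` for each
nontrivial supersolution `v`. Homogeneity of degree `q` improves `A` to `A^(q^n)`, which tends to 1.
-/

/-! ### Weak-type estimates and distribution functions -/

/-- The constant in the passage from a weak-type estimate to an `L^q` estimate, `0 < q < 1`. -/
def weakTypeConst (q : ℝ) : ℝ≥0∞ := 1 + 2 ^ q * (1 - 2 ^ (q - 1))⁻¹

lemma weakTypeConst_ne_top {q : ℝ} (hq1 : q < 1) : weakTypeConst q ≠ ∞ := by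
  have h : (2 : ℝ≥0∞) ^ (q - 1) < 1 :=
    ENNReal.rpow_lt_one_of_one_lt_of_neg (by norm_num) (by linarith)
  refine ENNReal.add_ne_top.2 ⟨by simp, ENNReal.mul_ne_top ?_ ?_⟩
  · exact ENNReal.rpow_ne_top_of_ne_zero (by simp) (by simp)
  · exact ENNReal.inv_ne_top.2 (tsub_pos_of_lt h).ne'

/-- For finite `a > T`, the single `k` with `2^k T < a ≤ 2^(k+1) T` already suffices; for `a = ∞`
every term is at least `T^q` and the sum diverges. -/
lemma rpow_le_add_tsum_dyadic {q : ℝ} (hq0 : 0 < q) {T : ℝ≥0∞} (hT0 : T ≠ 0) (hT : T ≠ ∞)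
    (a : ℝ≥0∞) :
    a ^ q ≤ T ^ q + ∑' k : ℕ, if 2 ^ k * T < a then (2 * (2 ^ k * T)) ^ q else 0 := by
  rcases le_or_gt a T with h | h
  · exact (ENNReal.rpow_le_rpow h hq0.le).trans le_self_add
  refine le_trans ?_ le_add_self
  by_cases ha : a = ∞
  · subst ha
    have : (∑' k : ℕ, if 2 ^ k * T < ∞ then (2 * (2 ^ k * T)) ^ q else 0) = ∞ := by
      refine top_le_iff.1 ((ENNReal.tsum_const_eq_top_of_ne_zero (α := ℕ)
        (ENNReal.rpow_pos (pos_iff_ne_zero.2 hT0) hT : 0 < T ^ q).ne').ge.trans ?_)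
      refine ENNReal.tsum_le_tsum fun k => ?_
      rw [if_pos (ENNReal.mul_lt_top (by simp) hT.lt_top)]
      refine ENNReal.rpow_le_rpow ?_ hq0.le
      rw [← mul_assoc]
      refine le_mul_of_one_le_left' ?_
      exact one_le_mul (by norm_num) (one_le_pow₀ (by norm_num))
    rw [this]; exact le_top
  · have hex : ∃ n : ℕ, a ≤ 2 ^ n * T := by
      obtain ⟨n, hn⟩ := ENNReal.exists_nat_gt (ENNReal.div_ne_top ha hT0)
      refine ⟨n, ?_⟩
      have h2 : (n : ℝ≥0∞) ≤ 2 ^ n := by exact_mod_cast (Nat.lt_two_pow_self).le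
      rw [← ENNReal.div_le_iff hT0 hT]
      exact hn.le.trans h2
    classical
    obtain ⟨k, hk⟩ : ∃ k, Nat.find hex = k + 1 := by
      refine Nat.exists_eq_succ_of_ne_zero fun h0 => ?_
      have := Nat.find_spec hex
      rw [h0] at this
      simp only [pow_zero, one_mul] at this
      exact absurd this (not_le.2 h)
    have h1 : 2 ^ k * T < a := by
      have := Nat.find_min hex (m := k) (by omega)
      exact not_le.1 this
    have h2 : a ≤ 2 * (2 ^ k * T) := by
      have := Nat.find_spec hex
      rw [hk, pow_succ'] at this
      rwa [← mul_assoc]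
    refine le_trans ?_ (ENNReal.le_tsum k)
    rw [if_pos h1]
    exact ENNReal.rpow_le_rpow h2 hq0.le

/-- A weak-type `(1, 1)` estimate on a finite measure space implies an `L^q` estimate, `q < 1`. -/
lemma lintegral_rpow_le_of_weakType {α : Type*} [MeasurableSpace α] {ω : Measure α}
    [IsFiniteMeasure ω] {q : ℝ} (hq0 : 0 < q) {h : α → ℝ≥0∞} (hh : AEMeasurable h ω)
    {A : ℝ≥0∞} (hw : ∀ t, t ≠ 0 → t ≠ ∞ → t * ω {x | t < h x} ≤ A) :
    ∫⁻ x, h x ^ q ∂ω ≤ weakTypeConst q * (ω Set.univ ^ (1 - q) * A ^ q) := by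
  rcases eq_or_ne (ω Set.univ) 0 with hW0 | hW0
  · rw [Measure.measure_univ_eq_zero] at hW0
    simp [hW0]
  have hW : ω Set.univ ≠ ∞ := measure_ne_top _ _
  have hWq0 : ω Set.univ ^ (1 - q) ≠ 0 := (ENNReal.rpow_pos (pos_iff_ne_zero.2 hW0) hW).ne'
  rcases eq_or_ne A ∞ with rfl | hA
  · rw [ENNReal.top_rpow_of_pos hq0, ENNReal.mul_top hWq0, ENNReal.mul_top]
    · exact le_top
    · exact (add_pos_of_pos_of_nonneg one_pos zero_le).ne'
  rcases eq_or_ne A 0 with rfl | hA0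
  · have h0 : h =ᵐ[ω] 0 := by
      have hn : ∀ n : ℕ, ω {x | ((n : ℝ≥0∞) + 1)⁻¹ < h x} = 0 := fun n => by
        have := hw (((n : ℝ≥0∞) + 1)⁻¹) (ENNReal.inv_ne_zero.2 (by finiteness)) (by simp)
        simpa using this
      rw [← measure_iUnion_null_iff] at hn
      refine measure_mono_null (fun x hx => ?_) hn
      obtain ⟨n, hn⟩ := ENNReal.exists_inv_nat_lt (a := h x) (by simpa using hx)
      refine Set.mem_iUnion.2 ⟨n, lt_of_le_of_lt ?_ hn⟩
      exact ENNReal.inv_le_inv.2 le_self_add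
    have : ∫⁻ x, h x ^ q ∂ω = 0 := by
      rw [lintegral_eq_zero_iff' (hh.pow_const q)]
      filter_upwards [h0] with x hx
      simp [hx, hq0]
    rw [this]; exact zero_le
  set W := ω Set.univ with hWdef
  -- The height at which the trivial bound `W` and the weak-type bound `A / t` for the distribution
  -- function agree. Above it, the dyadic levels decay geometrically with ratio `2^(q-1) < 1`.
  set T := A / W with hTdef
  have hT0 : T ≠ 0 := (ENNReal.div_pos hA0 hW).ne'
  have hT : T ≠ ∞ := ENNReal.div_ne_top hA hW0
  have hTW : T ^ q * W = W ^ (1 - q) * A ^ q := by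
    rw [hTdef, ENNReal.div_rpow_of_nonneg _ _ hq0.le, ENNReal.rpow_sub _ _ hW0 hW,
      ENNReal.rpow_one, div_eq_mul_inv, div_eq_mul_inv]
    ring
  have hTA : T ^ (q - 1) * A = W ^ (1 - q) * A ^ q := by
    rw [← hTW, ENNReal.rpow_sub _ _ hT0 hT, ENNReal.rpow_one, div_eq_mul_inv, mul_assoc]
    congr 1
    rw [hTdef, ENNReal.inv_div (Or.inl hW) (Or.inl hW0), ENNReal.div_mul_cancel hA0 hA]
  have hbound : ∀ k : ℕ, (2 * (2 ^ k * T)) ^ q * ω {x | 2 ^ k * T < h x}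
      ≤ 2 ^ q * (W ^ (1 - q) * A ^ q) * (2 ^ (q - 1)) ^ k := by
    intro k
    have hs0 : (2 : ℝ≥0∞) ^ k * T ≠ 0 := mul_ne_zero (by simp) hT0
    have hs : (2 : ℝ≥0∞) ^ k * T ≠ ∞ := ENNReal.mul_ne_top (by simp) hT
    have e1 : (2 ^ k * T) ^ q = (2 ^ (q - 1)) ^ k * T ^ (q - 1) * (2 ^ k * T) := by
      have : ((2 : ℝ≥0∞) ^ (q - 1)) ^ k = (2 ^ k) ^ (q - 1) := by
        rw [← ENNReal.rpow_natCast, ← ENNReal.rpow_natCast, ← ENNReal.rpow_mul,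
          ← ENNReal.rpow_mul, mul_comm]
      rw [this, ← ENNReal.mul_rpow_of_ne_zero (by simp) hT0]
      nth_rw 3 [← ENNReal.rpow_one (2 ^ k * T)]
      rw [← ENNReal.rpow_add _ _ hs0 hs]
      congr 1; ring
    rw [ENNReal.mul_rpow_of_nonneg _ _ hq0.le, e1, ← hTA]
    calc 2 ^ q * ((2 ^ (q - 1)) ^ k * T ^ (q - 1) * (2 ^ k * T)) * ω {x | 2 ^ k * T < h x}
        = 2 ^ q * ((2 ^ (q - 1)) ^ k * T ^ (q - 1) * (2 ^ k * T * ω {x | 2 ^ k * T < h x})) := by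
          ring
      _ ≤ 2 ^ q * ((2 ^ (q - 1)) ^ k * T ^ (q - 1) * A) := by gcongr; exact hw _ hs0 hs
      _ = _ := by ring
  calc ∫⁻ x, h x ^ q ∂ω
      ≤ ∫⁻ x, (T ^ q + ∑' k : ℕ,
          {x | 2 ^ k * T < h x}.indicator (fun _ => (2 * (2 ^ k * T)) ^ q) x) ∂ω := by
        refine lintegral_mono fun x => ?_
        simpa only [Set.indicator_apply, Set.mem_ofPred_eq] using
          rpow_le_add_tsum_dyadic hq0 hT0 hT (h x)
    _ = T ^ q * W + ∑' k : ℕ, ∫⁻ x,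
          {x | 2 ^ k * T < h x}.indicator (fun _ => (2 * (2 ^ k * T)) ^ q) x ∂ω := by
        rw [lintegral_add_left measurable_const, lintegral_const, lintegral_tsum]
        exact fun k => aemeasurable_const.indicator₀ (nullMeasurableSet_lt aemeasurable_const hh)
    _ ≤ T ^ q * W + ∑' k : ℕ, 2 ^ q * (W ^ (1 - q) * A ^ q) * (2 ^ (q - 1)) ^ k := by
        gcongr with k
        exact (lintegral_indicator_const_le _ _).trans (hbound k)
    _ = weakTypeConst q * (W ^ (1 - q) * A ^ q) := by
        rw [ENNReal.tsum_mul_left, ENNReal.tsum_geometric, hTW, weakTypeConst]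
        ring

/-- The distribution of the distribution function of `g` is dominated by the uniform one. -/
lemma measure_setOf_measure_le_lt_le {α β : Type*} [MeasurableSpace α] [CompleteLinearOrder β]
    [TopologicalSpace β] [OrderTopology β] [FirstCountableTopology β]
    (ω : Measure α) (g : α → β) (t : ℝ≥0∞) :
    ω {y | ω {z | g z ≤ g y} < t} ≤ t := by
  set S := {y | ω {z | g z ≤ g y} < t} with hS
  rcases S.eq_empty_or_nonempty with h | hne
  · rw [h]; simp
  -- If `g` has a maximum over `S`, then `S` lies in one sublevel set of measure below `t`.
  -- Otherwise increasing sublevel sets at points of `S` cover it.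
  by_cases hatt : ∃ y ∈ S, ∀ z ∈ S, g z ≤ g y
  · obtain ⟨y, hy, hmax⟩ := hatt
    exact (measure_mono hmax).trans (le_of_lt hy)
  push Not at hatt
  obtain ⟨s, hmono, hlim, hmem⟩ :=
    exists_seq_tendsto_sSup (hne.image g) (OrderTop.bddAbove (g '' S))
  have hsub : S ⊆ ⋃ n, {z | g z ≤ s n} := by
    intro y hy
    obtain ⟨z, hz, hlt⟩ := hatt y hy
    have : g y < sSup (g '' S) := hlt.trans_le (le_sSup (Set.mem_image_of_mem g hz))
    obtain ⟨n, hn⟩ := (hlim.eventually (lt_mem_nhds this)).exists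
    exact Set.mem_iUnion.2 ⟨n, hn.le⟩
  refine (measure_mono hsub).trans ?_
  have hmono' : Monotone fun n => {z | g z ≤ s n} :=
    fun i j hij z (hz : g z ≤ s i) => hz.trans (hmono hij)
  rw [hmono'.measure_iUnion]
  refine iSup_le fun n => ?_
  obtain ⟨y, hy, hyn⟩ := hmem n
  rw [← hyn]
  exact le_of_lt hy

/-! ### Radial integrals against `dr / r²` -/

lemma lintegral_Ioi_inv_sq {c : ℝ} (hc : 0 < c) :
    ∫⁻ r in Set.Ioi c, (ENNReal.ofReal (r ^ 2))⁻¹ = ENNReal.ofReal c⁻¹ := by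
  have h1 : ∫⁻ r in Set.Ioi c, (ENNReal.ofReal (r ^ 2))⁻¹
      = ∫⁻ r in Set.Ioi c, ENNReal.ofReal (r ^ (-2 : ℝ)) := by
    refine setLIntegral_congr_fun measurableSet_Ioi fun r hr => ?_
    have hr0 : 0 < r := hc.trans hr
    rw [← ENNReal.ofReal_inv_of_pos (by positivity), Real.rpow_neg hr0.le]
    norm_num
  rw [h1, ← ofReal_integral_eq_lintegral_ofReal
    (integrableOn_Ioi_rpow_of_lt (by norm_num) hc), integral_Ioi_rpow_of_lt (by norm_num) hc]
  · norm_num [Real.rpow_neg_one]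
  · filter_upwards [ae_restrict_mem measurableSet_Ioi] with r hr
    exact Real.rpow_nonneg (hc.trans hr).le _

/-- Layer cake for a single value: for finite positive `g` the condition reads `r > 1 / (s g)`, and
the integral of `r⁻²` over that range is `s g`. -/
lemma setLIntegral_Ioi_indicator_inv_sq {s : ℝ} (hs : 0 < s) (g : ℝ≥0∞) :
    ∫⁻ r in Set.Ioi (0 : ℝ), {r : ℝ | ENNReal.ofReal (1 / (s * r)) < g}.indicator
      (fun r => (ENNReal.ofReal (r ^ 2))⁻¹) r = ENNReal.ofReal s * g := by
  have hmeas : MeasurableSet {r : ℝ | ENNReal.ofReal (1 / (s * r)) < g} :=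
    measurableSet_lt (by fun_prop) measurable_const
  rw [setLIntegral_indicator hmeas]
  have fin : ∀ c : ℝ, 0 < c → ∫⁻ r in {r : ℝ | ENNReal.ofReal (1 / (s * r)) < ENNReal.ofReal c} ∩
      Set.Ioi 0, (ENNReal.ofReal (r ^ 2))⁻¹ = ENNReal.ofReal s * ENNReal.ofReal c := by
    intro c hc
    have e : {r : ℝ | ENNReal.ofReal (1 / (s * r)) < ENNReal.ofReal c} ∩ Set.Ioi 0
        = Set.Ioi (s * c)⁻¹ := by
      ext r
      simp only [Set.mem_inter_iff, Set.mem_ofPred_eq, Set.mem_Ioi,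
        ENNReal.ofReal_lt_ofReal_iff hc]
      constructor
      · rintro ⟨h, hr⟩
        rw [div_lt_iff₀ (by positivity)] at h
        rw [inv_lt_iff_one_lt_mul₀ (by positivity)]
        linarith
      · intro h
        have hr : 0 < r := lt_trans (by positivity) h
        refine ⟨?_, hr⟩
        rw [inv_lt_iff_one_lt_mul₀ (by positivity)] at h
        rw [div_lt_iff₀ (by positivity)]
        linarith
    rw [e, lintegral_Ioi_inv_sq (by positivity), inv_inv, ENNReal.ofReal_mul hs.le]
  rcases eq_or_ne g 0 with rfl | hg0
  · simp
  rcases eq_or_ne g ∞ with rfl | hg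
  · rw [ENNReal.mul_top (ENNReal.ofReal_pos.2 hs).ne', ← top_le_iff]
    refine ENNReal.le_of_forall_nnreal_lt fun b _ => ?_
    have hb : 0 < (b + 1 : ℝ) / s := by positivity
    calc (b : ℝ≥0∞) ≤ ENNReal.ofReal s * ENNReal.ofReal ((b + 1) / s) := by
          rw [← ENNReal.ofReal_mul hs.le, mul_div_cancel₀ _ hs.ne', ← ENNReal.ofReal_coe_nnreal]
          exact ENNReal.ofReal_le_ofReal (by linarith)
      _ ≤ _ := by
          rw [← fin _ hb]
          refine lintegral_mono_set (Set.inter_subset_inter_left _ fun r hr => ?_)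
          exact lt_trans hr (ENNReal.ofReal_lt_top)
  · have := fin g.toReal (ENNReal.toReal_pos hg0 hg)
    rwa [ENNReal.ofReal_toReal hg] at this

/-! ### Geometry of quasi-metric balls and the layer cake formula -/

section Kernel

variable {Ω : Type*} {G : Ω → Ω → ℝ≥0∞} {κ : ℝ≥0}

lemma IsQuasiMetric.kernel_le (hκ : 0 < κ) {a b : ℝ≥0∞} (h : a⁻¹ ≤ 2 * κ * b⁻¹) :
    b ≤ 2 * κ * a := by
  have h0 : (2 * κ : ℝ≥0∞) ≠ 0 := by simp [hκ.ne']
  have ht : (2 * κ : ℝ≥0∞) ≠ ∞ := by finiteness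
  have h1 := ENNReal.inv_le_inv.2 h
  rw [inv_inv, ENNReal.mul_inv (Or.inl h0) (Or.inl ht), inv_inv] at h1
  rwa [← ENNReal.div_eq_inv_mul, ENNReal.div_le_iff h0 ht, mul_comm] at h1

/-- With `d = 1 / G`, the hypothesis is `d(x, y) ≤ d(x, z)`, so `d(y, z) ≤ κ (d(y, x) + d(x, z)) ≤
2κ d(x, z)`. -/
lemma IsQuasiMetric.kernel_le_of_kernel_le (hd : IsQuasiMetric G κ) (hκ : 0 < κ)
    {x y z : Ω} (h : G x z ≤ G x y) : G x z ≤ 2 * κ * G y z := by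
  apply IsQuasiMetric.kernel_le hκ
  calc (G y z)⁻¹ ≤ κ * ((G y x)⁻¹ + (G x z)⁻¹) := hd.quasi_triangle y z x
    _ ≤ κ * ((G x z)⁻¹ + (G x z)⁻¹) := by
      rw [hd.symm y x]; gcongr
    _ = 2 * κ * (G x z)⁻¹ := by ring

variable [TopologicalSpace Ω]

lemma IsKernel.inv_ne_top (hG : IsKernel G) (x y : Ω) : (G x y)⁻¹ ≠ ∞ :=
  ENNReal.inv_ne_top.2 (hG.pos x y).ne'

lemma IsKernel.mem_ball_iff (hG : IsKernel G) {x y : Ω} {r : ℝ} (hr : 0 < r) :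
    y ∈ ball G x r ↔ (G x y)⁻¹.toReal < r := by
  rw [← ENNReal.lt_ofReal_iff_toReal_lt (hG.inv_ne_top x y), ball, Set.mem_ofPred_eq, one_div,
    ENNReal.ofReal_inv_of_pos hr, ENNReal.inv_lt_iff_inv_lt]

lemma IsKernel.ball_subset_ball (hG : IsKernel G) (x : Ω) {r s : ℝ} (hr : 0 < r) (h : r ≤ s) :
    ball G x r ⊆ ball G x s := fun y hy => by
  rw [hG.mem_ball_iff (hr.trans_le h)]
  exact ((hG.mem_ball_iff hr).1 hy).trans_le h

lemma IsQuasiMetric.toReal_inv_le (hG : IsKernel G) (hd : IsQuasiMetric G κ) (x y z : Ω) :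
    (G x y)⁻¹.toReal ≤ κ * ((G x z)⁻¹.toReal + (G z y)⁻¹.toReal) := by
  have h := hd.quasi_triangle x y z
  have hxz := hG.inv_ne_top x z
  have hzy := hG.inv_ne_top z y
  rw [← ENNReal.toReal_add hxz hzy, ← ENNReal.coe_toReal, ← ENNReal.toReal_mul]
  exact ENNReal.toReal_mono (by finiteness) h

/-- If two balls meet, then a dilation of the smaller one is contained in a dilation of the
larger one. -/
lemma IsQuasiMetric.ball_subset_of_inter_nonempty (hG : IsKernel G) (hd : IsQuasiMetric G κ)
    (hκ : 0 < κ) {x y : Ω} {r s : ℝ} (hr : 0 < r) (hs : 0 < s) (hrs : r ≤ 2 * s)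
    (h : (ball G x r ∩ ball G y s).Nonempty) :
    ball G x (2 * κ * r) ⊆ ball G y (7 * κ ^ 2 * s) := by
  have hκ' : (0 : ℝ) < κ := by exact_mod_cast hκ
  obtain ⟨w, hxw, hyw⟩ := h
  intro z hz
  rw [hG.mem_ball_iff (by positivity)] at *
  have h1 := hd.toReal_inv_le hG y z x
  have h2 := hd.toReal_inv_le hG y x w
  rw [hd.symm w x] at h2
  -- The constant is `7κ² = κ (3κ + 4κ)`: `d(y, x) ≤ κ (s + r) ≤ 3κs`, while `d(x, z) < 2κr ≤ 4κs`.
  have h3 : (κ : ℝ) * ((G y w)⁻¹.toReal + (G x w)⁻¹.toReal) ≤ κ * (3 * s) := by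
    gcongr; linarith
  have h4 : 2 * κ * r ≤ 2 * κ * (2 * s) := by gcongr
  refine h1.trans_lt ?_
  have : (κ : ℝ) * ((G y x)⁻¹.toReal + (G x z)⁻¹.toReal) < κ * (κ * (3 * s) + 2 * κ * (2 * s)) := by
    gcongr ?_ * ?_
    linarith
  linarith

/-- Since `d(x, x)` need not vanish, a ball may miss its own centre; but `d(x, x) ≤ 2κ d(x, w)` for
any `w` in the ball. -/
lemma IsQuasiMetric.mem_ball_self (hG : IsKernel G) (hd : IsQuasiMetric G κ) (hκ : 0 < κ) {x : Ω}
    {r : ℝ} (hr : 0 < r) (h : (ball G x r).Nonempty) : x ∈ ball G x (2 * κ * r) := by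
  have hκ' : (0 : ℝ) < κ := by exact_mod_cast hκ
  obtain ⟨w, hw⟩ := h
  rw [hG.mem_ball_iff (by positivity)] at *
  have h1 := hd.toReal_inv_le hG x x w
  rw [hd.symm w x] at h1
  refine h1.trans_lt ?_
  rw [mul_comm 2 (κ : ℝ), mul_assoc]
  gcongr
  linarith

/-- Points of a ball are equivalent as poles, as seen from the complement of a dilated ball. -/
lemma IsQuasiMetric.kernel_le_of_mem_ball (hG : IsKernel G) (hd : IsQuasiMetric G κ) (hκ : 0 < κ)
    {x y z : Ω} {r : ℝ} (hr : 0 < r) (hy : y ∈ ball G x r) (hz : z ∉ ball G x (2 * κ * r)) :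
    G y z ≤ 2 * κ * G x z := by
  have hκ' : (0 : ℝ) < κ := by exact_mod_cast hκ
  rw [hG.mem_ball_iff (by positivity)] at hy hz
  push Not at hz
  apply IsQuasiMetric.kernel_le hκ
  have h1 := hd.toReal_inv_le hG x z y
  have h2 : (κ : ℝ) * (G x y)⁻¹.toReal ≤ κ * r := by gcongr
  -- As `2κr ≤ d(x, z)`, the term `κr` is at most half the left side and is absorbed.
  have h3 : (G x z)⁻¹.toReal ≤ 2 * κ * (G y z)⁻¹.toReal := by linarith
  have hyz := hG.inv_ne_top y z
  rw [← ENNReal.toReal_le_toReal (hG.inv_ne_top x z) (by finiteness)]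
  simpa using h3

lemma IsKernel.isOpen_ball (hG : IsKernel G) (x : Ω) (r : ℝ) : IsOpen (ball G x r) :=
  (hG.lsc.comp (Continuous.prodMk_right x)).isOpen_preimage _

variable [MeasurableSpace Ω] [OpensMeasurableSpace Ω]

lemma IsKernel.measurableSet_ball (hG : IsKernel G) (x : Ω) (r : ℝ) :
    MeasurableSet (ball G x r) :=
  (hG.isOpen_ball x r).measurableSet

lemma IsKernel.measurable_right (hG : IsKernel G) (x : Ω) : Measurable (G x) :=
  (hG.lsc.comp (Continuous.prodMk_right x)).measurable

/-- A measure whose potential is finite at some point is locally finite. -/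
lemma IsKernel.isLocallyFiniteMeasure {ν : Measure Ω} (hG : IsKernel G) {x : Ω}
    (h : potential G ν x ≠ ∞) : IsLocallyFiniteMeasure ν := by
  refine ⟨fun y => ?_⟩
  obtain ⟨c, hc0, hc⟩ := exists_between (hG.pos x y)
  have hev := (hG.lsc.comp (Continuous.prodMk_right x)) y c hc
  refine ⟨{z | c < G x z}, hev, ?_⟩
  refine (measure_mono fun z (hz : c < G x z) => hz.le).trans_lt
    ((meas_ge_le_lintegral_div (hG.measurable_right x).aemeasurable hc0.ne' hc.ne_top).trans_lt ?_)
  exact (ENNReal.div_ne_top h hc0.ne').lt_top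

lemma IsKernel.measure_ball_ne_top {ν : Measure Ω} (hG : IsKernel G) {x : Ω} {r : ℝ} (hr : 0 < r)
    (h : potential G ν x ≠ ∞) : ν (ball G x r) ≠ ∞ := by
  have h0 : ENNReal.ofReal (1 / r) ≠ 0 := (ENNReal.ofReal_pos.2 (by positivity)).ne'
  refine ne_top_of_le_ne_top (ENNReal.div_ne_top h h0) ((measure_mono ?_).trans
    (meas_ge_le_lintegral_div (hG.measurable_right x).aemeasurable h0 ENNReal.ofReal_ne_top))
  exact fun z (hz : _ < G x z) => hz.le

/-- The layer cake representation of a potential in terms of the measures of balls. -/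
lemma IsKernel.lintegral_measure_ball (hG : IsKernel G) (ν : Measure Ω) [SFinite ν] (x : Ω) {s : ℝ}
    (hs : 0 < s) :
    ∫⁻ r in Set.Ioi (0 : ℝ), ν (ball G x (s * r)) / ENNReal.ofReal (r ^ 2)
      = ENNReal.ofReal s * potential G ν x := by
  have hS : MeasurableSet {p : ℝ × Ω | ENNReal.ofReal (1 / (s * p.1)) < G x p.2} :=
    measurableSet_lt (by fun_prop) ((hG.measurable_right x).comp measurable_snd)
  calc ∫⁻ r in Set.Ioi (0 : ℝ), ν (ball G x (s * r)) / ENNReal.ofReal (r ^ 2)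
      = ∫⁻ r in Set.Ioi (0 : ℝ), ∫⁻ y,
          {p : ℝ × Ω | ENNReal.ofReal (1 / (s * p.1)) < G x p.2}.indicator
          (fun p => (ENNReal.ofReal (p.1 ^ 2))⁻¹) (r, y) ∂ν := by
        refine lintegral_congr fun r => ?_
        have : (fun y => {p : ℝ × Ω | ENNReal.ofReal (1 / (s * p.1)) < G x p.2}.indicator
            (fun p => (ENNReal.ofReal (p.1 ^ 2))⁻¹) (r, y))
            = (ball G x (s * r)).indicator fun _ => (ENNReal.ofReal (r ^ 2))⁻¹ := by
          ext y; simp [Set.indicator_apply, ball]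
        rw [this, lintegral_indicator_const (hG.measurableSet_ball _ _), div_eq_mul_inv, mul_comm]
    _ = ∫⁻ y, (∫⁻ r in Set.Ioi (0 : ℝ),
          {p : ℝ × Ω | ENNReal.ofReal (1 / (s * p.1)) < G x p.2}.indicator
            (fun p => (ENNReal.ofReal (p.1 ^ 2))⁻¹) (r, y)) ∂ν := by
        refine lintegral_lintegral_swap (f := fun r y => {p : ℝ × Ω |
          ENNReal.ofReal (1 / (s * p.1)) < G x p.2}.indicator
          (fun p => (ENNReal.ofReal (p.1 ^ 2))⁻¹) (r, y)) (Measurable.aemeasurable ?_)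
        exact Measurable.indicator (by fun_prop) hS
    _ = ∫⁻ y, ENNReal.ofReal s * G x y ∂ν := by
        refine lintegral_congr fun y => ?_
        rw [← setLIntegral_Ioi_indicator_inv_sq hs (G x y)]
        rfl
    _ = _ := lintegral_const_mul _ (hG.measurable_right x)

lemma IsKernel.measurable_potential [SecondCountableTopology Ω] (hG : IsKernel G) (ν : Measure Ω)
    [SFinite ν] : Measurable (potential G ν) :=
  Measurable.lintegral_prod_right' (f := fun p : Ω × Ω => G p.1 p.2) hG.lsc.measurable

end Kernel

/-! ### Covering argument and strong-type estimate -/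

section WeakType

variable {Ω : Type*} {G : Ω → Ω → ℝ≥0∞} {κ : ℝ≥0} [TopologicalSpace Ω] [MeasurableSpace Ω]
  [OpensMeasurableSpace Ω]

/-- The Vitali covering estimate for finitely many balls. -/
lemma IsQuasiMetric.measure_biUnion_ball_le (hG : IsKernel G) (hd : IsQuasiMetric G κ)
    (hκ : 0 < κ) {ω ν : Measure Ω} {t : ℝ≥0∞} {ι : Type*} (x : ι → Ω) (r : ι → ℝ)
    (hr : ∀ i, 0 < r i)
    (h : ∀ i, t * ω (ball G (x i) (7 * κ ^ 2 * r i)) < ν (ball G (x i) (r i))) (s : Finset ι) :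
    t * ω (⋃ i ∈ s, ball G (x i) (2 * κ * r i)) ≤ ν Set.univ := by
  obtain ⟨R, hR⟩ := (s.finite_toSet.image r).bddAbove
  -- Each ball meets a selected one of at least half its radius, as `ball_subset_of_inter_nonempty`
  -- requires.
  obtain ⟨u, hus, hdisj, hcov⟩ := Vitali.exists_disjoint_subfamily_covering_enlargement
    (fun i => ball G (x i) (r i)) (s : Set ι) r 2 one_lt_two (fun i _ => (hr i).le) R
    (fun i hi => hR (Set.mem_image_of_mem r hi))
    (fun i _ => nonempty_of_measure_ne_zero (zero_le.trans_lt (h i)).ne')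
  have hu : u.Countable := (s.finite_toSet.subset hus).countable
  have hsub : (⋃ i ∈ s, ball G (x i) (2 * κ * r i))
      ⊆ ⋃ i ∈ u, ball G (x i) (7 * κ ^ 2 * r i) := by
    refine Set.iUnion₂_subset fun i hi => ?_
    obtain ⟨j, hj, hne, hle⟩ := hcov i hi
    exact (hd.ball_subset_of_inter_nonempty hG hκ (hr i) (hr j) hle hne).trans
      (Set.subset_biUnion_of_mem (u := fun i => ball G (x i) (7 * κ ^ 2 * r i)) hj)
  calc t * ω (⋃ i ∈ s, ball G (x i) (2 * κ * r i))
      ≤ t * ∑' i : u, ω (ball G (x i) (7 * κ ^ 2 * r i)) := by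
        gcongr
        exact (measure_mono hsub).trans (measure_biUnion_le _ hu _)
    _ = ∑' i : u, t * ω (ball G (x i) (7 * κ ^ 2 * r i)) := ENNReal.tsum_mul_left.symm
    _ ≤ ∑' i : u, ν (ball G (x i) (r i)) := ENNReal.tsum_le_tsum fun i => (h i).le
    _ = ν (⋃ i ∈ u, ball G (x i) (r i)) :=
        (measure_biUnion hu hdisj fun i _ => hG.measurableSet_ball _ _).symm
    _ ≤ ν Set.univ := measure_mono (Set.subset_univ _)

variable [SecondCountableTopology Ω]

/-- The weak-type `(1, 1)` estimate for the quotient of two potentials. -/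
lemma IsQuasiMetric.mul_measure_potential_lt_le (hG : IsKernel G) (hd : IsQuasiMetric G κ)
    (hκ : 0 < κ) (ω ν : Measure Ω) [SFinite ω] [SFinite ν] (t : ℝ≥0∞) :
    t * ω {x | t * (ENNReal.ofReal (7 * κ ^ 2) * potential G ω x) < potential G ν x}
      ≤ ν Set.univ := by
  have hκ' : (0 : ℝ) < κ := by exact_mod_cast hκ
  set F := {x | ∃ r : ℝ, 0 < r ∧ t * ω (ball G x (7 * κ ^ 2 * r)) < ν (ball G x r)} with hF
  -- Outside `F` the reverse ball inequality holds at every radius; integrated against `dr / r²` it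
  -- becomes an inequality between potentials.
  have hsubF : {x | t * (ENNReal.ofReal (7 * κ ^ 2) * potential G ω x) < potential G ν x} ⊆ F := by
    intro x (hx : t * (ENNReal.ofReal (7 * κ ^ 2) * potential G ω x) < potential G ν x)
    by_contra hxF
    have hall : ∀ r : ℝ, 0 < r → ν (ball G x r) ≤ t * ω (ball G x (7 * κ ^ 2 * r)) := by
      intro r hr
      by_contra hlt
      exact hxF ⟨r, hr, not_le.1 hlt⟩
    refine absurd hx (not_lt.2 ?_)
    have h1 := hG.lintegral_measure_ball ν x one_pos
    rw [ENNReal.ofReal_one, one_mul] at h1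
    have hmeas : AEMeasurable (fun r : ℝ => ω (ball G x (7 * κ ^ 2 * r)) / ENNReal.ofReal (r ^ 2))
        (volume.restrict (Set.Ioi 0)) := by
      refine AEMeasurable.div (aemeasurable_restrict_of_monotoneOn measurableSet_Ioi ?_)
        (by fun_prop)
      intro r hr s _ hrs
      have hr : 0 < r := hr
      exact measure_mono (hG.ball_subset_ball x (by positivity) (by gcongr))
    rw [← h1, ← hG.lintegral_measure_ball ω x (by positivity), ← lintegral_const_mul'' _ hmeas]
    refine setLIntegral_mono' measurableSet_Ioi fun r hr => ?_
    rw [one_mul, ← mul_div_assoc]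
    gcongr
    exact hall r hr
  choose r hr h using fun x : F => x.2
  -- The radii may be unbounded on `F`, so the Vitali estimate is applied to finite families. The
  -- dilated balls are open and contain their centres, so countably many cover `F`, and finite
  -- unions exhaust these.
  obtain ⟨T, hT, hTU⟩ := TopologicalSpace.isOpen_iUnion_countable
    (fun x : F => ball G (x : Ω) (2 * κ * r x)) fun x => hG.isOpen_ball _ _
  have hcov : F ⊆ ⋃ s : Finset T, ⋃ i ∈ s, ball G (i : F).1 (2 * κ * r i) := by
    intro x hx
    have hx' : x ∈ ⋃ x : F, ball G (x : Ω) (2 * κ * r x) :=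
      Set.mem_iUnion.2 ⟨⟨x, hx⟩, hd.mem_ball_self hG hκ (hr _)
        (nonempty_of_measure_ne_zero (zero_le.trans_lt (h ⟨x, hx⟩)).ne')⟩
    rw [← hTU] at hx'
    obtain ⟨i, hi, hxi⟩ := Set.mem_iUnion₂.1 hx'
    exact Set.mem_iUnion.2 ⟨{⟨i, hi⟩}, by simpa using hxi⟩
  have := hT.to_subtype
  have hmono : Monotone fun s : Finset T => ⋃ i ∈ s, ball G (i : F).1 (2 * κ * r i) :=
    fun s s' hss => Set.biUnion_subset_biUnion_left hss
  calc t * ω _ ≤ t * ω (⋃ s : Finset T, ⋃ i ∈ s, ball G (i : F).1 (2 * κ * r i)) := by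
        gcongr; exact hsubF.trans hcov
    _ = ⨆ s : Finset T, t * ω (⋃ i ∈ s, ball G (i : F).1 (2 * κ * r i)) := by
        rw [hmono.measure_iUnion, ENNReal.mul_iSup]
    _ ≤ ν Set.univ := iSup_le fun s => hd.measure_biUnion_ball_le hG hκ
        (fun i : T => (i : F).1) (fun i : T => r i) (fun i => hr i) (fun i => h i) s

/-- Strong-type estimate for potentials in the presence of a positive supersolution. -/
lemma IsQuasiMetric.lintegral_potential_rpow_le (hG : IsKernel G) (hd : IsQuasiMetric G κ)
    (hκ : 0 < κ) {q : ℝ} (hq0 : 0 < q) {σ ν : Measure Ω} [SFinite σ] [SFinite ν]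
    {u : Ω → ℝ≥0∞} (hu : Measurable u) (hpos : ∀ᵐ x ∂σ, 0 < u x) (htop : ∀ᵐ x ∂σ, u x < ∞)
    (hle : ∀ᵐ x ∂σ, potential G (σ.withDensity fun y => u y ^ q) x ≤ u x)
    (hfin : σ.withDensity (fun y => u y ^ q) Set.univ ≠ ∞) :
    ∫⁻ x, potential G ν x ^ q ∂σ ≤ weakTypeConst q *
      (σ.withDensity (fun y => u y ^ q) Set.univ ^ (1 - q) *
        (ENNReal.ofReal (7 * κ ^ 2) * ν Set.univ) ^ q) := by
  have hκ' : (0 : ℝ) < κ := by exact_mod_cast hκ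
  set ω := σ.withDensity fun y => u y ^ q with hω
  have hac : ω ≪ σ := withDensity_absolutelyContinuous _ _
  have : IsFiniteMeasure ω := ⟨hfin.lt_top⟩
  have hquot : Measurable fun x => potential G ν x / u x := (hG.measurable_potential ν).div hu
  -- Since `0 < u < ∞`, the integral moves to the finite measure `ω`, where `Gν / u ≤ Gν / Gω`
  -- inherits the weak-type bound.
  have e : ∫⁻ x, potential G ν x ^ q ∂σ = ∫⁻ x, (potential G ν x / u x) ^ q ∂ω := by
    rw [hω, lintegral_withDensity_eq_lintegral_mul _ (hu.pow_const q)
      (hquot.pow_const q)]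
    refine lintegral_congr_ae ?_
    filter_upwards [hpos, htop] with x h0 ht
    simp only [Pi.mul_apply]
    rw [← ENNReal.mul_rpow_of_nonneg _ _ hq0.le, ENNReal.mul_div_cancel h0.ne' ht.ne]
  rw [e]
  refine lintegral_rpow_le_of_weakType hq0 hquot.aemeasurable fun t ht0 ht => ?_
  set a := ENNReal.ofReal (7 * κ ^ 2) with ha
  have ha0 : a ≠ 0 := (ENNReal.ofReal_pos.2 (by positivity)).ne'
  have hat : a ≠ ∞ := ENNReal.ofReal_ne_top
  have h1 := hd.mul_measure_potential_lt_le hG hκ ω ν (t / a)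
  have h2 : ω {x | t < potential G ν x / u x}
      ≤ ω {x | t / a * (a * potential G ω x) < potential G ν x} := by
    refine measure_mono_ae ?_
    filter_upwards [hac hpos, hac htop, hac hle] with x h0 htx hlex
    intro (hx : t < potential G ν x / u x)
    rw [ENNReal.lt_div_iff_mul_lt (Or.inl h0.ne') (Or.inl htx.ne)] at hx
    refine lt_of_le_of_lt ?_ hx
    rw [← mul_assoc, ENNReal.div_mul_cancel ha0 hat]
    gcongr
  calc t * ω {x | t < potential G ν x / u x}
      = a * (t / a * ω {x | t < potential G ν x / u x}) := by
        rw [← mul_assoc, ENNReal.mul_div_cancel ha0 hat]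
    _ ≤ a * ν Set.univ := by
        gcongr
        exact (mul_le_mul_right h2 _).trans h1

end WeakType

/-! ### Least constants of localized inequalities -/

/-- The function `(Gσ)^{1/(1-q)} + Kσ` that governs the bilateral estimates for a quasi-metric
kernel. -/
def intrinsicBound {Ω : Type*} [TopologicalSpace Ω] [MeasurableSpace Ω] (G : Ω → Ω → ℝ≥0∞) (q : ℝ)
    (σ : Measure Ω) (x : Ω) : ℝ≥0∞ :=
  potential G σ x ^ (1 / (1 - q)) + intrinsicPotential G q σ x

section LeastConst

variable {Ω : Type*} [TopologicalSpace Ω] [MeasurableSpace Ω] {G : Ω → Ω → ℝ≥0∞} {q : ℝ}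
  {σ : Measure Ω}

lemma leastConst_mono (hq0 : 0 < q) {E F : Set Ω} (h : E ⊆ F) :
    leastConst G q σ E ≤ leastConst G q σ F := by
  refine sInf_le_sInf fun C hC ν hν => le_trans ?_ (hC ν hν)
  gcongr

/-- The infimum is itself admissible for finite `ν`: if `ν ≠ 0`, dividing by its mass bounds every
admissible constant below by the same quotient. -/
lemma setLIntegral_potential_rpow_le_leastConst (hq0 : 0 < q) (E : Set Ω) (ν : Measure Ω)
    [hν : IsLocallyFiniteMeasure ν] (hfin : ν Set.univ ≠ ∞) :
    ∫⁻ x in E, potential G ν x ^ q ∂σ ≤ leastConst G q σ E ^ q * ν Set.univ ^ q := by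
  rw [← ENNReal.mul_rpow_of_nonneg _ _ hq0.le, ← ENNReal.rpow_inv_le_iff hq0, inv_eq_one_div]
  rcases eq_or_ne (ν Set.univ) 0 with h0 | h0
  · rw [Measure.measure_univ_eq_zero] at h0
    simp [h0, potential, hq0]
  · rw [← ENNReal.div_le_iff h0 hfin]
    refine le_sInf fun C hC => ?_
    rw [ENNReal.div_le_iff h0 hfin]
    exact hC ν hν

end LeastConst

/-! ### Lower bounds for supersolutions of the quasi-metric problem -/

section Lower

variable {Ω : Type*} {G : Ω → Ω → ℝ≥0∞} {κ : ℝ≥0} [TopologicalSpace Ω] [MeasurableSpace Ω]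
  [OpensMeasurableSpace Ω] {q : ℝ} {σ : Measure Ω} {u : Ω → ℝ≥0∞}

/-- Let `lam = G(x, ·) dω`, so that `Gσ(x) = ∫ u^(-q) dlam`, and let `φ(y)` be the `lam`-measure of
`{z | G x z ≤ G x y}`. On this set `G x z ≤ 2κ G y z`, hence `φ ≤ 2κ Gω ≤ 2κ u` almost everywhere.
As a distribution function, `φ` has `1/φ` in weak `L¹(lam)` with constant 1, and the total mass of
`lam` is `Gω(x)`. -/
lemma IsQuasiMetric.potential_le_rpow (hG : IsKernel G) (hd : IsQuasiMetric G κ)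
    (hκ : 0 < κ) (hq0 : 0 < q) (hq1 : q < 1) [SFinite σ] (hu : Measurable u)
    (hpos : ∀ᵐ x ∂σ, 0 < u x) (htop : ∀ᵐ x ∂σ, u x < ∞)
    (hle : ∀ᵐ x ∂σ, potential G (σ.withDensity fun y => u y ^ q) x ≤ u x) (x : Ω) :
    potential G σ x ≤ (2 * κ) ^ q * weakTypeConst q *
      potential G (σ.withDensity fun y => u y ^ q) x ^ (1 - q) := by
  have hq : 0 < 1 - q := by linarith
  set ω := σ.withDensity fun y => u y ^ q with hω
  have hac : ω ≪ σ := withDensity_absolutelyContinuous _ _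
  have hGx := hG.measurable_right x
  set lam := ω.withDensity (G x) with hlam
  have hac' : lam ≪ σ := (withDensity_absolutelyContinuous _ _).trans hac
  have huniv : lam Set.univ = potential G ω x := by
    rw [hlam, withDensity_apply _ MeasurableSet.univ, Measure.restrict_univ, potential]
  have hk0 : (2 * κ : ℝ≥0∞) ≠ 0 := by simp [hκ.ne']
  have hkt : (2 * κ : ℝ≥0∞) ≠ ∞ := by finiteness
  rcases eq_or_ne (potential G ω x) ∞ with hX | hX
  · rw [hX, ENNReal.top_rpow_of_pos hq, ENNReal.mul_top]
    · exact le_top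
    · exact mul_ne_zero (ENNReal.rpow_pos (pos_iff_ne_zero.2 hk0) hkt).ne'
        (add_pos_of_pos_of_nonneg one_pos zero_le).ne'
  have : IsFiniteMeasure lam := ⟨by rw [huniv]; exact hX.lt_top⟩
  set φ : Ω → ℝ≥0∞ := fun y => lam {z | G x z ≤ G x y} with hφ
  have hφm : Measurable φ := by
    have : Monotone fun c => lam {z | G x z ≤ c} :=
      fun c c' h => measure_mono fun z (hz : G x z ≤ c) => hz.trans h
    exact this.measurable.comp hGx
  have huq : Measurable fun y => (u y)⁻¹ ^ q := hu.inv.pow_const q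
  have hφq : Measurable fun y => (φ y)⁻¹ ^ q := hφm.inv.pow_const q
  have hφle : ∀ y, φ y ≤ 2 * κ * potential G ω y := by
    intro y
    have hS : MeasurableSet {z | G x z ≤ G x y} := measurableSet_le hGx measurable_const
    calc φ y = ∫⁻ z in {z | G x z ≤ G x y}, G x z ∂ω := withDensity_apply _ hS
      _ ≤ ∫⁻ z in {z | G x z ≤ G x y}, 2 * κ * G y z ∂ω :=
          setLIntegral_mono' hS fun z hz => hd.kernel_le_of_kernel_le hκ hz
      _ ≤ ∫⁻ z, 2 * κ * G y z ∂ω := setLIntegral_le_lintegral _ _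
      _ = 2 * κ * potential G ω y := lintegral_const_mul _ (hG.measurable_right y)
  have hweak : ∫⁻ y, (φ y)⁻¹ ^ q ∂lam ≤ weakTypeConst q * (lam Set.univ ^ (1 - q) * 1 ^ q) := by
    refine lintegral_rpow_le_of_weakType hq0 hφm.inv.aemeasurable fun t ht0 ht => ?_
    have h := measure_setOf_measure_le_lt_le lam (G x) t⁻¹
    have e : {y | t < (φ y)⁻¹} = {y | φ y < t⁻¹} := by
      ext y; exact ENNReal.lt_inv_iff_lt_inv
    calc t * lam {y | t < (φ y)⁻¹} ≤ t * t⁻¹ := by rw [e]; gcongr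
      _ = 1 := ENNReal.mul_inv_cancel ht0 ht
  calc potential G σ x = ∫⁻ y, (u y)⁻¹ ^ q ∂lam := by
        rw [hlam, lintegral_withDensity_eq_lintegral_mul _ hGx huq, hω,
          lintegral_withDensity_eq_lintegral_mul _ (hu.pow_const q)
            (hGx.mul huq)]
        refine lintegral_congr_ae ?_
        filter_upwards [hpos, htop] with y h0 ht
        simp only [Pi.mul_apply]
        rw [mul_left_comm, ← ENNReal.mul_rpow_of_nonneg _ _ hq0.le,
          ENNReal.mul_inv_cancel h0.ne' ht.ne, ENNReal.one_rpow, mul_one]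
    _ ≤ ∫⁻ y, (2 * κ) ^ q * (φ y)⁻¹ ^ q ∂lam := by
        refine lintegral_mono_ae ?_
        filter_upwards [hac' hle] with y hy
        rw [← ENNReal.mul_rpow_of_nonneg _ _ hq0.le]
        gcongr
        have : φ y ≤ 2 * κ * u y := (hφle y).trans (by gcongr)
        rw [ENNReal.inv_le_iff_inv_le, ENNReal.mul_inv (Or.inl hk0) (Or.inl hkt), inv_inv,
          ← ENNReal.div_eq_inv_mul, ENNReal.div_le_iff hk0 hkt, mul_comm]
        exact this
    _ ≤ _ := by
        rw [lintegral_const_mul _ hφq, mul_assoc]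
        gcongr
        simpa [huniv] using hweak

variable [SecondCountableTopology Ω]

/-- The function `u` remains a supersolution for `σ` restricted to `E`, so the strong-type estimate
gives `ϰ(E)^q ≲ ω(E)^(1-q)`. -/
lemma IsQuasiMetric.leastConst_rpow_le (hG : IsKernel G) (hd : IsQuasiMetric G κ)
    (hκ : 0 < κ) (hq0 : 0 < q) (hq1 : q < 1) [SFinite σ] (hu : Measurable u)
    (hpos : ∀ᵐ x ∂σ, 0 < u x) (htop : ∀ᵐ x ∂σ, u x < ∞)
    (hle : ∀ᵐ x ∂σ, potential G (σ.withDensity fun y => u y ^ q) x ≤ u x) (E : Set Ω) :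
    leastConst G q σ E ^ (q / (1 - q)) ≤
      (weakTypeConst q * ENNReal.ofReal (7 * κ ^ 2) ^ q) ^ (1 / (1 - q))
        * σ.withDensity (fun y => u y ^ q) E := by
  have hκ' : (0 : ℝ) < κ := by exact_mod_cast hκ
  have hq : 0 < 1 - q := by linarith
  set ω := σ.withDensity fun y => u y ^ q with hω
  set a := ENNReal.ofReal (7 * κ ^ 2) with ha
  have ha0 : a ≠ 0 := (ENNReal.ofReal_pos.2 (by positivity)).ne'
  have hres : ω.restrict E = (σ.restrict E).withDensity fun y => u y ^ q :=
    restrict_withDensity' E _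
  have huniv : (σ.restrict E).withDensity (fun y => u y ^ q) Set.univ = ω E := by
    rw [← hres, Measure.restrict_apply_univ]
  have hC0 : weakTypeConst q * a ^ q ≠ 0 :=
    mul_ne_zero (add_pos_of_pos_of_nonneg one_pos zero_le).ne'
      (ENNReal.rpow_pos (pos_iff_ne_zero.2 ha0) ENNReal.ofReal_ne_top).ne'
  rcases eq_or_ne (ω E) ∞ with hW | hW
  · rw [hW, ENNReal.mul_top]
    · exact le_top
    · simp [ENNReal.rpow_eq_zero_iff, hC0, hq1.le, hq]
  have hbound : leastConst G q σ E ≤ (weakTypeConst q * a ^ q * ω E ^ (1 - q)) ^ (1 / q) := by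
    refine sInf_le fun ν hν => ?_
    have h := hd.lintegral_potential_rpow_le hG hκ hq0 (σ := σ.restrict E) (ν := ν) hu
      (ae_restrict_of_ae hpos) (ae_restrict_of_ae htop) ?_ (by rwa [huniv])
    · rw [huniv] at h
      rw [one_div, ENNReal.rpow_inv_le_iff hq0, ENNReal.mul_rpow_of_nonneg _ _ hq0.le,
        ENNReal.rpow_inv_rpow hq0.ne']
      refine h.trans (le_of_eq ?_)
      rw [ENNReal.mul_rpow_of_nonneg _ _ hq0.le]
      ring
    · refine ae_restrict_of_ae (hle.mono fun x hx => le_trans ?_ hx)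
      rw [← hres]
      exact lintegral_mono' Measure.restrict_le_self le_rfl
  calc leastConst G q σ E ^ (q / (1 - q))
      ≤ ((weakTypeConst q * a ^ q * ω E ^ (1 - q)) ^ (1 / q)) ^ (q / (1 - q)) := by
        gcongr
    _ = _ := by
        rw [← ENNReal.rpow_mul, show 1 / q * (q / (1 - q)) = 1 / (1 - q) by field_simp,
          ENNReal.mul_rpow_of_nonneg _ _ (by positivity), ← ENNReal.rpow_mul (ω E),
          mul_one_div_cancel hq.ne', ENNReal.rpow_one]

lemma IsQuasiMetric.intrinsicPotential_le (hG : IsKernel G) (hd : IsQuasiMetric G κ)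
    (hκ : 0 < κ) (hq0 : 0 < q) (hq1 : q < 1) [SFinite σ] (hu : Measurable u)
    (hpos : ∀ᵐ x ∂σ, 0 < u x) (htop : ∀ᵐ x ∂σ, u x < ∞)
    (hle : ∀ᵐ x ∂σ, potential G (σ.withDensity fun y => u y ^ q) x ≤ u x) (x : Ω) :
    intrinsicPotential G q σ x ≤
      (weakTypeConst q * ENNReal.ofReal (7 * κ ^ 2) ^ q) ^ (1 / (1 - q))
        * potential G (σ.withDensity fun y => u y ^ q) x := by
  have hq : 0 < 1 - q := by linarith
  have h1 := hG.lintegral_measure_ball (σ.withDensity fun y => u y ^ q) x one_pos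
  simp only [ENNReal.ofReal_one, one_mul] at h1
  rw [← h1, ← lintegral_const_mul']
  · refine lintegral_mono fun r => ?_
    rw [← mul_div_assoc]
    gcongr
    exact hd.leastConst_rpow_le hG hκ hq0 hq1 hu hpos htop hle _
  · exact ENNReal.rpow_ne_top_of_nonneg (by positivity) (ENNReal.mul_ne_top
      (weakTypeConst_ne_top hq1) (ENNReal.rpow_ne_top_of_nonneg hq0.le ENNReal.ofReal_ne_top))

/-- The constant in the lower bound for supersolutions. -/
def lowerConst (q : ℝ) (κ : ℝ≥0) : ℝ≥0∞ :=
  ((2 * κ) ^ q * weakTypeConst q) ^ (1 / (1 - q))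
    + (weakTypeConst q * ENNReal.ofReal (7 * κ ^ 2) ^ q) ^ (1 / (1 - q))

lemma lowerConst_ne_top (hq0 : 0 < q) (hq1 : q < 1) : lowerConst q κ ≠ ∞ := by
  have hq : 0 < 1 - q := by linarith
  have hw := weakTypeConst_ne_top hq1
  refine ENNReal.add_ne_top.2 ⟨ENNReal.rpow_ne_top_of_nonneg (by positivity)
    (ENNReal.mul_ne_top ?_ hw), ENNReal.rpow_ne_top_of_nonneg (by positivity)
    (ENNReal.mul_ne_top hw ?_)⟩
  · exact ENNReal.rpow_ne_top_of_nonneg hq0.le (by finiteness)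
  · exact ENNReal.rpow_ne_top_of_nonneg hq0.le (by finiteness)

/-- The lower bound for the potential of a supersolution. -/
lemma IsQuasiMetric.intrinsicBound_le (hG : IsKernel G) (hd : IsQuasiMetric G κ)
    (hκ : 0 < κ) (hq0 : 0 < q) (hq1 : q < 1) [SFinite σ] (hu : Measurable u)
    (hpos : ∀ᵐ x ∂σ, 0 < u x) (htop : ∀ᵐ x ∂σ, u x < ∞)
    (hle : ∀ᵐ x ∂σ, potential G (σ.withDensity fun y => u y ^ q) x ≤ u x) (x : Ω) :
    intrinsicBound G q σ x ≤
      lowerConst q κ * potential G (σ.withDensity fun y => u y ^ q) x := by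
  have hq : 0 < 1 - q := by linarith
  rw [intrinsicBound, lowerConst, add_mul]
  refine add_le_add ?_ (hd.intrinsicPotential_le hG hκ hq0 hq1 hu hpos htop hle x)
  rw [one_div, ENNReal.rpow_inv_le_iff hq, ENNReal.mul_rpow_of_nonneg _ _ hq.le,
    ENNReal.rpow_inv_rpow hq.ne']
  exact hd.potential_le_rpow hG hκ hq0 hq1 hu hpos htop hle x

end Lower

/-! ### Upper bounds for subsolutions of the quasi-metric problem -/

section Upper

variable {Ω : Type*} {G : Ω → Ω → ℝ≥0∞} {κ : ℝ≥0} [TopologicalSpace Ω] [MeasurableSpace Ω]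
  [OpensMeasurableSpace Ω] {q : ℝ} {σ μ : Measure Ω} {u : Ω → ℝ≥0∞}

/-- Inside a ball, the potential of a measure is controlled by the potential of its restriction to
a dilated ball and by the potential at the centre. -/
lemma IsQuasiMetric.potential_le_restrict_add (hG : IsKernel G) (hd : IsQuasiMetric G κ)
    (hκ : 0 < κ) (ν : Measure Ω) {x y : Ω} {r : ℝ} (hr : 0 < r) (hy : y ∈ ball G x r) :
    potential G ν y ≤ potential G (ν.restrict (ball G x (2 * κ * r))) y
      + 2 * κ * potential G ν x := by
  have hB := hG.measurableSet_ball x (2 * κ * r)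
  rw [potential, ← lintegral_add_compl _ hB]
  refine add_le_add le_rfl ?_
  calc ∫⁻ z in (ball G x (2 * κ * r))ᶜ, G y z ∂ν
      ≤ ∫⁻ z in (ball G x (2 * κ * r))ᶜ, 2 * κ * G x z ∂ν :=
        setLIntegral_mono' hB.compl fun z hz => hd.kernel_le_of_mem_ball hG hκ hr hy hz
    _ ≤ ∫⁻ z, 2 * κ * G x z ∂ν := setLIntegral_le_lintegral _ _
    _ = 2 * κ * potential G ν x := lintegral_const_mul _ (hG.measurable_right x)

/-- Hölder's inequality for `dr / r²` with exponents `1/(1-q)` and `1/q`; the second factor is the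
layer cake of `Gν(x)` with radii dilated by `2κ`. -/
lemma IsKernel.lintegral_leastConst_mul_le (hG : IsKernel G) (hκ : 0 < κ) (hq0 : 0 < q)
    (hq1 : q < 1) (ν : Measure Ω) [SFinite ν] (x : Ω) :
    ∫⁻ r in Set.Ioi (0 : ℝ), leastConst G q σ (ball G x r) ^ q *
        ν (ball G x (2 * κ * r)) ^ q / ENNReal.ofReal (r ^ 2)
      ≤ intrinsicPotential G q σ x ^ (1 - q) * (2 * κ * potential G ν x) ^ q := by
  have hκ' : (0 : ℝ) < κ := by exact_mod_cast hκ
  have hq : 0 < 1 - q := by linarith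
  have h1 := hG.lintegral_measure_ball ν x (s := 2 * κ) (by positivity)
  have hcoe : ENNReal.ofReal (2 * κ) = 2 * κ := by
    rw [ENNReal.ofReal_mul zero_le_two]; simp
  rw [hcoe] at h1
  have m1 : AEMeasurable (fun r : ℝ => leastConst G q σ (ball G x r) ^ (q / (1 - q)) /
      ENNReal.ofReal (r ^ 2)) (volume.restrict (Set.Ioi 0)) := by
    refine AEMeasurable.div (aemeasurable_restrict_of_monotoneOn measurableSet_Ioi ?_)
      (by fun_prop)
    intro r hr s _ hrs
    have := leastConst_mono (G := G) (σ := σ) hq0 (hG.ball_subset_ball x hr hrs)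
    simp only
    gcongr
  have m2 : AEMeasurable (fun r : ℝ => ν (ball G x (2 * κ * r)) / ENNReal.ofReal (r ^ 2))
      (volume.restrict (Set.Ioi 0)) := by
    refine AEMeasurable.div (aemeasurable_restrict_of_monotoneOn measurableSet_Ioi ?_)
      (by fun_prop)
    intro r hr s _ hrs
    have hr : 0 < r := hr
    exact measure_mono (hG.ball_subset_ball x (by positivity) (by gcongr))
  rw [← h1, intrinsicPotential]
  refine le_trans (le_of_eq ?_) (ENNReal.lintegral_mul_norm_pow_le m1 m2 hq.le hq0.le (by ring))
  refine setLIntegral_congr_fun measurableSet_Ioi fun r hr => ?_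
  have hr2 : ENNReal.ofReal (r ^ 2) ≠ 0 := (ENNReal.ofReal_pos.2 (pow_pos hr 2)).ne'
  rw [ENNReal.div_rpow_of_nonneg _ _ hq.le, ENNReal.div_rpow_of_nonneg _ _ hq0.le,
    ← ENNReal.rpow_mul, div_mul_cancel₀ _ hq.ne', div_eq_mul_inv, div_eq_mul_inv, div_eq_mul_inv,
    mul_mul_mul_comm, ← ENNReal.mul_inv, ← ENNReal.rpow_add _ _ hr2 ENNReal.ofReal_ne_top,
    sub_add_cancel, ENNReal.rpow_one]
  · left
    exact (ENNReal.rpow_pos (pos_iff_ne_zero.2 hr2) ENNReal.ofReal_ne_top).ne'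
  · left
    exact ENNReal.rpow_ne_top_of_nonneg hq.le ENNReal.ofReal_ne_top

/-- Either `X ≤ M`, or `X ≤ 2 S X^q`; in the latter case finiteness of `X` allows division by `X^q`.
-/
lemma le_of_le_mul_rpow_add_rpow (hq0 : 0 < q) (hq1 : q < 1) {X M S : ℝ≥0∞} (hX : X ≠ ∞)
    (h : X ≤ S * (X ^ q + M ^ q)) : X ≤ (2 * S) ^ (1 / (1 - q)) + M := by
  have hq : 0 < 1 - q := by linarith
  rcases le_or_gt X M with hXM | hXM
  · exact hXM.trans le_add_self
  refine le_trans ?_ le_self_add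
  have hX0 : X ≠ 0 := (zero_le.trans_lt hXM).ne'
  rw [one_div, ENNReal.le_rpow_inv_iff hq, ENNReal.rpow_sub _ _ hX0 hX, ENNReal.rpow_one,
    ENNReal.div_le_iff (ENNReal.rpow_pos (pos_iff_ne_zero.2 hX0) hX).ne'
      (ENNReal.rpow_ne_top_of_nonneg hq0.le hX)]
  calc X ≤ S * (X ^ q + M ^ q) := h
    _ ≤ S * (X ^ q + X ^ q) := by gcongr
    _ = 2 * S * X ^ q := by ring

variable [SecondCountableTopology Ω]

/-- Integrate `u^q ≤ (Gω + Gμ)^q` over the ball, using subadditivity of `t^q`. The measures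
restricted to the dilated ball are finite, so the least constant applies to them; the rest is
bounded by a constant on the ball. -/
lemma IsQuasiMetric.withDensity_ball_le (hG : IsKernel G) (hd : IsQuasiMetric G κ)
    (hκ : 0 < κ) (hq0 : 0 < q) (hq1 : q < 1) [SFinite σ]
    (hle : ∀ᵐ x ∂σ, u x ≤ sublinearMap G q σ μ u x) {x : Ω}
    (hX : potential G (σ.withDensity fun y => u y ^ q) x ≠ ∞) (hM : potential G μ x ≠ ∞)
    {r : ℝ} (hr : 0 < r) :
    σ.withDensity (fun y => u y ^ q) (ball G x r) ≤
      leastConst G q σ (ball G x r) ^ q *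
        σ.withDensity (fun y => u y ^ q) (ball G x (2 * κ * r)) ^ q
      + leastConst G q σ (ball G x r) ^ q * μ (ball G x (2 * κ * r)) ^ q
      + (2 * κ) ^ q * (potential G (σ.withDensity fun y => u y ^ q) x ^ q + potential G μ x ^ q)
        * σ (ball G x r) := by
  have hκ' : (0 : ℝ) < κ := by exact_mod_cast hκ
  set ω := σ.withDensity fun y => u y ^ q with hω
  have hB := hG.measurableSet_ball x r
  set B := ball G x r with hBdef
  set B' := ball G x (2 * κ * r) with hB'
  have := hG.isLocallyFiniteMeasure hX
  have := hG.isLocallyFiniteMeasure hM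
  have hωB' : ω B' ≠ ∞ := hG.measure_ball_ne_top (by positivity) hX
  have hμB' : μ B' ≠ ∞ := hG.measure_ball_ne_top (by positivity) hM
  have e1 := setLIntegral_potential_rpow_le_leastConst (G := G) (σ := σ) hq0 B (ω.restrict B')
    (by rwa [Measure.restrict_apply_univ])
  have e2 := setLIntegral_potential_rpow_le_leastConst (G := G) (σ := σ) hq0 B (μ.restrict B')
    (by rwa [Measure.restrict_apply_univ])
  rw [Measure.restrict_apply_univ] at e1 e2
  have m1 : Measurable fun y => potential G (ω.restrict B') y ^ q :=
    (hG.measurable_potential _).pow_const q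
  have m2 : Measurable fun y => potential G (μ.restrict B') y ^ q :=
    (hG.measurable_potential _).pow_const q
  calc ω B = ∫⁻ y in B, u y ^ q ∂σ := withDensity_apply _ hB
    _ ≤ ∫⁻ y in B, (potential G (ω.restrict B') y ^ q + potential G (μ.restrict B') y ^ q
          + (2 * κ) ^ q * (potential G ω x ^ q + potential G μ x ^ q)) ∂σ := by
        refine lintegral_mono_ae ?_
        filter_upwards [ae_restrict_of_ae hle, ae_restrict_mem hB] with y hy hyB
        have h1 := hd.potential_le_restrict_add hG hκ ω hr hyB
        have h2 := hd.potential_le_restrict_add hG hκ μ hr hyB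
        calc u y ^ q ≤ ((potential G (ω.restrict B') y + 2 * κ * potential G ω x)
              + (potential G (μ.restrict B') y + 2 * κ * potential G μ x)) ^ q := by
              gcongr
              exact hy.trans (add_le_add h1 h2)
          _ ≤ (potential G (ω.restrict B') y ^ q + (2 * κ * potential G ω x) ^ q)
              + (potential G (μ.restrict B') y ^ q + (2 * κ * potential G μ x) ^ q) := by
              refine (ENNReal.rpow_add_le_add_rpow _ _ hq0.le hq1.le).trans (add_le_add ?_ ?_) <;>
              exact ENNReal.rpow_add_le_add_rpow _ _ hq0.le hq1.le
          _ = _ := by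
              rw [ENNReal.mul_rpow_of_nonneg (2 * κ) (potential G ω x) hq0.le,
                ENNReal.mul_rpow_of_nonneg (2 * κ) (potential G μ x) hq0.le]
              ring
    _ = ∫⁻ y in B, potential G (ω.restrict B') y ^ q ∂σ
        + ∫⁻ y in B, potential G (μ.restrict B') y ^ q ∂σ
        + (2 * κ) ^ q * (potential G ω x ^ q + potential G μ x ^ q) * σ B := by
        rw [lintegral_add_right _ measurable_const, lintegral_add_left m1, setLIntegral_const]
    _ ≤ _ := by gcongr

/-- The constant in the upper bound for subsolutions. -/
def upperConst (q : ℝ) (κ : ℝ≥0) : ℝ≥0∞ :=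
  (2 * (2 * κ) ^ q) ^ (1 / (1 - q)) * 2 ^ (1 / (1 - q) - 1) + 1

lemma upperConst_ne_top (hq0 : 0 < q) (hq1 : q < 1) : upperConst q κ ≠ ∞ := by
  have hq : 0 < 1 - q := by linarith
  refine ENNReal.add_ne_top.2 ⟨ENNReal.mul_ne_top (ENNReal.rpow_ne_top_of_nonneg (by positivity)
    (ENNReal.mul_ne_top (by simp) (ENNReal.rpow_ne_top_of_nonneg hq0.le (by finiteness)))) ?_,
    by simp⟩
  exact ENNReal.rpow_ne_top_of_ne_zero (by simp) (by simp)

/-- The upper bound for the potential of a subsolution. -/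
lemma IsQuasiMetric.potential_le_intrinsicBound (hG : IsKernel G) (hd : IsQuasiMetric G κ)
    (hκ : 0 < κ) (hq0 : 0 < q) (hq1 : q < 1) [SFinite σ]
    (hle : ∀ᵐ x ∂σ, u x ≤ sublinearMap G q σ μ u x) {x : Ω}
    (hX : potential G (σ.withDensity fun y => u y ^ q) x ≠ ∞) (hM : potential G μ x ≠ ∞) :
    potential G (σ.withDensity fun y => u y ^ q) x ≤
      upperConst q κ * (intrinsicBound G q σ x + potential G μ x) := by
  have hq : 0 < 1 - q := by linarith
  have hμ := hG.isLocallyFiniteMeasure hM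
  set ω := σ.withDensity fun y => u y ^ q with hω
  set X := potential G ω x with hXdef
  set M := potential G μ x with hMdef
  set K := intrinsicPotential G q σ x with hK
  set D : ℝ≥0∞ := (2 * κ) ^ q with hD
  have layer : ∀ ν : Measure Ω, SFinite ν → ∫⁻ r in Set.Ioi (0 : ℝ),
      ν (ball G x r) / ENNReal.ofReal (r ^ 2) = potential G ν x := by
    intro ν _
    have := hG.lintegral_measure_ball ν x one_pos
    simpa only [ENNReal.ofReal_one, one_mul] using this
  have mball : ∀ ν : Measure Ω, ∀ s : ℝ, 0 < s →
      AEMeasurable (fun r : ℝ => ν (ball G x (s * r))) (volume.restrict (Set.Ioi 0)) := by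
    intro ν s hs
    refine aemeasurable_restrict_of_monotoneOn measurableSet_Ioi fun r hr t _ hrt => ?_
    exact measure_mono (hG.ball_subset_ball x (mul_pos hs hr) (by gcongr))
  have mσ : AEMeasurable (fun r : ℝ => σ (ball G x r) / ENNReal.ofReal (r ^ 2))
      (volume.restrict (Set.Ioi 0)) := by
    have := mball σ 1 one_pos
    simp only [one_mul] at this
    exact this.div (by fun_prop)
  have hκ2 : (0 : ℝ) < 2 * κ := by
    have : (0 : ℝ) < κ := by exact_mod_cast hκ
    positivity
  have mL : AEMeasurable (fun r : ℝ => leastConst G q σ (ball G x r) ^ q)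
      (volume.restrict (Set.Ioi 0)) := by
    refine aemeasurable_restrict_of_monotoneOn measurableSet_Ioi fun r hr t _ hrt => ?_
    have := leastConst_mono (G := G) (σ := σ) hq0 (hG.ball_subset_ball x hr hrt)
    gcongr
  have mLν : ∀ ν : Measure Ω, AEMeasurable (fun r : ℝ => leastConst G q σ (ball G x r) ^ q *
      ν (ball G x (2 * κ * r)) ^ q / ENNReal.ofReal (r ^ 2)) (volume.restrict (Set.Ioi 0)) :=
    fun ν => (mL.mul ((mball ν _ hκ2).pow_const q)).div (by fun_prop)
  have key : X ≤ D * (K ^ (1 - q) + potential G σ x) * (X ^ q + M ^ q) := by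
    calc X = ∫⁻ r in Set.Ioi (0 : ℝ), ω (ball G x r) / ENNReal.ofReal (r ^ 2) :=
          (layer ω inferInstance).symm
      _ ≤ ∫⁻ r in Set.Ioi (0 : ℝ), (leastConst G q σ (ball G x r) ^ q *
            ω (ball G x (2 * κ * r)) ^ q / ENNReal.ofReal (r ^ 2)
          + leastConst G q σ (ball G x r) ^ q *
            μ (ball G x (2 * κ * r)) ^ q / ENNReal.ofReal (r ^ 2)
          + D * (X ^ q + M ^ q) * (σ (ball G x r) / ENNReal.ofReal (r ^ 2))) := by
          refine setLIntegral_mono' measurableSet_Ioi fun r hr => ?_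
          rw [← mul_div_assoc, ← ENNReal.add_div, ← ENNReal.add_div]
          gcongr
          exact hd.withDensity_ball_le hG hκ hq0 hq1 hle hX hM hr
      _ = (∫⁻ r in Set.Ioi (0 : ℝ), leastConst G q σ (ball G x r) ^ q *
            ω (ball G x (2 * κ * r)) ^ q / ENNReal.ofReal (r ^ 2))
          + (∫⁻ r in Set.Ioi (0 : ℝ), leastConst G q σ (ball G x r) ^ q *
            μ (ball G x (2 * κ * r)) ^ q / ENNReal.ofReal (r ^ 2))
          + D * (X ^ q + M ^ q) * potential G σ x := by
          rw [lintegral_add_right' _ (mσ.const_mul _), lintegral_add_left' (mLν ω),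
            lintegral_const_mul'' _ mσ, layer σ inferInstance]
      _ ≤ K ^ (1 - q) * (2 * κ * X) ^ q + K ^ (1 - q) * (2 * κ * M) ^ q
          + D * (X ^ q + M ^ q) * potential G σ x := by
          gcongr
          · exact hG.lintegral_leastConst_mul_le hκ hq0 hq1 ω x
          · exact hG.lintegral_leastConst_mul_le hκ hq0 hq1 μ x
      _ = _ := by
          rw [ENNReal.mul_rpow_of_nonneg (2 * κ) X hq0.le,
            ENNReal.mul_rpow_of_nonneg (2 * κ) M hq0.le]
          ring
  have hp : 1 ≤ 1 / (1 - q) := by rw [le_div_iff₀ hq]; linarith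
  have hp0 : 0 ≤ 1 / (1 - q) := by positivity
  calc X ≤ (2 * (D * (K ^ (1 - q) + potential G σ x))) ^ (1 / (1 - q)) + M :=
        le_of_le_mul_rpow_add_rpow hq0 hq1 hX key
    _ = (2 * D) ^ (1 / (1 - q)) * (K ^ (1 - q) + potential G σ x) ^ (1 / (1 - q)) + M := by
        rw [← mul_assoc, ENNReal.mul_rpow_of_nonneg _ _ hp0]
    _ ≤ (2 * D) ^ (1 / (1 - q)) * (2 ^ (1 / (1 - q) - 1) *
          ((K ^ (1 - q)) ^ (1 / (1 - q)) + potential G σ x ^ (1 / (1 - q)))) + M := by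
        gcongr
        exact ENNReal.rpow_add_le_mul_rpow_add_rpow _ _ hp
    _ = (2 * D) ^ (1 / (1 - q)) * 2 ^ (1 / (1 - q) - 1) * intrinsicBound G q σ x + 1 * M := by
        rw [← ENNReal.rpow_mul K, mul_one_div_cancel hq.ne', ENNReal.rpow_one, intrinsicBound]
        ring
    _ ≤ upperConst q κ * intrinsicBound G q σ x + upperConst q κ * M := by
        gcongr
        · exact le_self_add
        · exact le_add_self
    _ = _ := by ring

end Upper

/-! ### Passage to the modified kernel -/

section Modified

variable {Ω : Type*} {G : Ω → Ω → ℝ≥0∞} {m : Ω → ℝ≥0} {κ : ℝ≥0} [TopologicalSpace Ω] {q : ℝ}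

lemma IsKernel.modKernel (hG : IsKernel G) (hm : Continuous m) (hpos : ∀ x, 0 < m x) :
    IsKernel (modKernel G m) where
  pos x y := ENNReal.div_pos (hG.pos x y).ne' (by finiteness)
  lsc := by
    intro p c hc
    have hne : ∀ p : Ω × Ω, (m p.1 : ℝ≥0∞) * m p.2 ≠ 0 := fun p =>
      mul_ne_zero (by exact_mod_cast (hpos _).ne') (by exact_mod_cast (hpos _).ne')
    have hnt : ∀ p : Ω × Ω, (m p.1 : ℝ≥0∞) * m p.2 ≠ ∞ := fun p => by finiteness
    have hlt : c * ((m p.1 : ℝ≥0∞) * m p.2) < G p.1 p.2 :=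
      (ENNReal.lt_div_iff_mul_lt (Or.inl (hne p)) (Or.inl (hnt p))).1 hc
    -- Lower semicontinuity keeps `G` above `a` near `p`, and continuity of `m` keeps the other side
    -- below it.
    obtain ⟨a, hca, ha⟩ := exists_between hlt
    have hcont : Continuous fun p : Ω × Ω => c * ((m p.1 : ℝ≥0∞) * m p.2) := by
      have : Continuous fun p : Ω × Ω => ((m p.1 * m p.2 : ℝ≥0) : ℝ≥0∞) :=
        ENNReal.continuous_coe.comp (by fun_prop)
      simp only [ENNReal.coe_mul] at this
      exact ENNReal.continuous_const_mul hc.ne_top |>.comp this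
    filter_upwards [hG.lsc p a ha, hcont.continuousAt.eventually (gt_mem_nhds hca)] with z h1 h2
    exact (ENNReal.lt_div_iff_mul_lt (Or.inl (hne z)) (Or.inl (hnt z))).2 (h2.trans h1)

variable [MeasurableSpace Ω] [OpensMeasurableSpace Ω] {σ μ : Measure Ω} {u : Ω → ℝ≥0∞}

lemma potential_eq_mul_potential_modKernel (hm : Continuous m) (hpos : ∀ x, 0 < m x)
    (ν : Measure Ω) (x : Ω) :
    potential G ν x
      = m x * potential (modKernel G m) (ν.withDensity fun y => (m y : ℝ≥0∞)) x := by
  have hmm : Measurable fun y => (m y : ℝ≥0∞) := hm.measurable.coe_nnreal_ennreal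
  have h0 : ∀ y, (m y : ℝ≥0∞) ≠ 0 := fun y => by exact_mod_cast (hpos y).ne'
  rw [potential, potential, lintegral_withDensity_eq_lintegral_mul_non_measurable _ hmm
    (ae_of_all _ fun y => ENNReal.coe_lt_top), ← lintegral_const_mul' _ _ ENNReal.coe_ne_top]
  refine lintegral_congr fun y => ?_
  rw [Pi.mul_apply, modKernel, ← mul_assoc,
    ENNReal.mul_div_cancel (mul_ne_zero (h0 x) (h0 y)) (by finiteness)]

lemma powMeasure_withDensity (hm : Continuous m) (hpos : ∀ x, 0 < m x) (σ : Measure Ω) :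
    (powMeasure m q σ).withDensity (fun y => (m y : ℝ≥0∞)) = powMeasure m (1 + q) σ := by
  have hmm : Measurable fun y => (m y : ℝ≥0∞) := hm.measurable.coe_nnreal_ennreal
  rw [powMeasure, ← withDensity_mul _ (hmm.pow_const q) hmm, powMeasure]
  congr 1
  ext y
  rw [Pi.mul_apply, add_comm, ENNReal.rpow_add _ _ (by exact_mod_cast (hpos y).ne')
    ENNReal.coe_ne_top, ENNReal.rpow_one]

/-- This is the source of the exponent `1 + q`: `u^q m = (u / m)^q m^(1+q)`. -/
lemma withDensity_rpow_withDensity (hq0 : 0 < q) (hm : Continuous m) (hpos : ∀ x, 0 < m x)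
    (σ : Measure Ω) (hu : Measurable u) :
    (σ.withDensity fun y => u y ^ q).withDensity (fun y => (m y : ℝ≥0∞))
      = (powMeasure m (1 + q) σ).withDensity fun y => (u y / m y) ^ q := by
  have hmm : Measurable fun y => (m y : ℝ≥0∞) := hm.measurable.coe_nnreal_ennreal
  have huq : Measurable fun y => (u y / m y) ^ q := (hu.div hmm).pow_const q
  rw [powMeasure, ← withDensity_mul _ (hu.pow_const q) hmm,
    ← withDensity_mul _ (hmm.pow_const _) huq]
  congr 1
  ext y
  have h0 : (m y : ℝ≥0∞) ≠ 0 := by exact_mod_cast (hpos y).ne'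
  rw [Pi.mul_apply, Pi.mul_apply, ENNReal.rpow_add _ _ h0 ENNReal.coe_ne_top, ENNReal.rpow_one,
    mul_assoc, ← ENNReal.mul_rpow_of_nonneg _ _ hq0.le,
    ENNReal.mul_div_cancel h0 ENNReal.coe_ne_top, mul_comm]

lemma modBound_eq (hm : Continuous m) (hpos : ∀ x, 0 < m x) (σ : Measure Ω) (x : Ω) :
    modBound G m q σ x
      = m x * intrinsicBound (modKernel G m) q (powMeasure m (1 + q) σ) x := by
  have h0 : (m x : ℝ≥0∞) ≠ 0 := by exact_mod_cast (hpos x).ne'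
  rw [modBound, potential_eq_mul_potential_modKernel hm hpos, powMeasure_withDensity hm hpos,
    mul_div_assoc, ENNReal.mul_div_cancel h0 ENNReal.coe_ne_top]
  rfl

lemma sublinearMap_eq (hq0 : 0 < q) (hm : Continuous m) (hpos : ∀ x, 0 < m x)
    (hu : Measurable u) (x : Ω) :
    sublinearMap G q σ μ u x = m x * sublinearMap (modKernel G m) q (powMeasure m (1 + q) σ)
      (μ.withDensity fun y => (m y : ℝ≥0∞)) (fun y => u y / m y) x := by
  rw [sublinearMap, sublinearMap, potential_eq_mul_potential_modKernel hm hpos,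
    potential_eq_mul_potential_modKernel hm hpos μ, withDensity_rpow_withDensity hq0 hm hpos _ hu,
    mul_add]

variable [SecondCountableTopology Ω]

/-- Bounding by the potential of `u^q dσ` rather than by `u` leaves `Gμ` untouched, so that it
enters the lower estimate with coefficient 1. -/
lemma IsNontrivialSupersolution.modBound_le (hq0 : 0 < q) (hq1 : q < 1) (hκ : 0 < κ) [SFinite σ]
    (hG : IsKernel G) (hmod : IsQuasiMetricallyModifiable G m κ)
    (hu : IsNontrivialSupersolution G q σ μ u) (x : Ω) :
    modBound G m q σ x ≤ lowerConst q κ * potential G (σ.withDensity fun y => u y ^ q) x := by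
  obtain ⟨hm, hpos, hd⟩ := hmod
  have hmm : Measurable fun y => (m y : ℝ≥0∞) := hm.measurable.coe_nnreal_ennreal
  have h0 : ∀ y, (m y : ℝ≥0∞) ≠ 0 := fun y => by exact_mod_cast (hpos y).ne'
  have hac : powMeasure m (1 + q) σ ≪ σ := withDensity_absolutelyContinuous _ _
  have : SFinite (powMeasure m (1 + q) σ) := by unfold powMeasure; infer_instance
  have h := hd.intrinsicBound_le (hG.modKernel hm hpos) hκ hq0 hq1
    (σ := powMeasure m (1 + q) σ) (u := fun y => u y / m y) (hu.measurable.div hmm)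
    (hac (hu.pos.mono fun y hy => ENNReal.div_pos hy.ne' ENNReal.coe_ne_top))
    (hac (hu.lt_top.mono fun y hy => ENNReal.div_lt_top hy.ne (h0 y)))
    (hac (hu.le.mono fun y hy => by
      rw [sublinearMap_eq hq0 hm hpos hu.measurable] at hy
      rw [ENNReal.le_div_iff_mul_le (Or.inl (h0 y)) (Or.inl ENNReal.coe_ne_top), mul_comm]
      refine le_trans ?_ hy
      gcongr
      exact le_self_add)) x
  rw [modBound_eq hm hpos, potential_eq_mul_potential_modKernel hm hpos,
    withDensity_rpow_withDensity hq0 hm hpos _ hu.measurable, mul_left_comm]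
  gcongr

lemma IsSubsolution.le_modBound (hq0 : 0 < q) (hq1 : q < 1) (hκ : 0 < κ) [SFinite σ]
    (hG : IsKernel G) (hmod : IsQuasiMetricallyModifiable G m κ)
    (hu : IsSubsolution G q σ μ u) :
    ∀ᵐ x ∂σ, u x ≤ (upperConst q κ + 1) * (modBound G m q σ x + potential G μ x) := by
  obtain ⟨hm, hpos, hd⟩ := hmod
  have h0 : ∀ y, (m y : ℝ≥0∞) ≠ 0 := fun y => by exact_mod_cast (hpos y).ne'
  have hac : powMeasure m (1 + q) σ ≪ σ := withDensity_absolutelyContinuous _ _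
  have : SFinite (powMeasure m (1 + q) σ) := by unfold powMeasure; infer_instance
  have hle : ∀ᵐ x ∂powMeasure m (1 + q) σ, u x / m x ≤ sublinearMap (modKernel G m) q
      (powMeasure m (1 + q) σ) (μ.withDensity fun y => (m y : ℝ≥0∞)) (fun y => u y / m y) x :=
    hac (hu.le.mono fun y hy => by
      rw [sublinearMap_eq hq0 hm hpos hu.measurable] at hy
      rwa [ENNReal.div_le_iff (h0 y) ENNReal.coe_ne_top, mul_comm])
  filter_upwards [hu.le, hu.lt_top] with x hx htop
  rw [sublinearMap_eq hq0 hm hpos hu.measurable] at hx htop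
  have hfin := (ENNReal.lt_top_of_mul_ne_top_right htop.ne (h0 x)).ne
  have hfin' := ENNReal.add_ne_top.1 hfin
  have h := hd.potential_le_intrinsicBound (hG.modKernel hm hpos) hκ hq0 hq1 hle hfin'.1 hfin'.2
  rw [modBound_eq hm hpos, potential_eq_mul_potential_modKernel hm hpos μ, ← mul_add,
    mul_left_comm]
  refine hx.trans ?_
  -- The extra 1 in the constant pays for the term `Gμ` of the equation itself.
  rw [sublinearMap, add_mul, one_mul]
  gcongr
  exact le_add_self

end Modified

/-! ### Comparison by sublinear iteration -/

section Uniqueness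

variable {Ω : Type*} [MeasurableSpace Ω] {G : Ω → Ω → ℝ≥0∞} {q : ℝ} {σ μ : Measure Ω}
  {u v : Ω → ℝ≥0∞}

/-- The nonlinear term scales by `B^q`, and the `μ`-term is harmless because `B^q ≥ 1`. -/
lemma sublinearMap_le_of_ae_le_mul (hq0 : 0 < q) (hv : Measurable v) {B : ℝ≥0∞} (hB : 1 ≤ B)
    (h : ∀ᵐ x ∂σ, u x ≤ B * v x) (x : Ω) :
    sublinearMap G q σ μ u x ≤ B ^ q * sublinearMap G q σ μ v x := by
  have h1 : σ.withDensity (fun y => u y ^ q) ≤ B ^ q • σ.withDensity fun y => v y ^ q := by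
    rw [← withDensity_smul _ (hv.pow_const q)]
    refine withDensity_mono (h.mono fun y hy => ?_)
    simp only [Pi.smul_apply, smul_eq_mul]
    rw [← ENNReal.mul_rpow_of_nonneg _ _ hq0.le]
    gcongr
  rw [sublinearMap, sublinearMap, mul_add]
  refine add_le_add ?_ (le_mul_of_one_le_left' (ENNReal.one_le_rpow hB hq0))
  refine (lintegral_mono' h1 le_rfl).trans (le_of_eq ?_)
  rw [lintegral_smul_measure, smul_eq_mul, potential]

/-- A subsolution that is dominated by a multiple of a supersolution is dominated by the
supersolution itself. -/
lemma ae_le_of_ae_le_mul (hq0 : 0 < q) (hq1 : q < 1) (hv : Measurable v)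
    (hsub : ∀ᵐ x ∂σ, u x ≤ sublinearMap G q σ μ u x)
    (hsup : ∀ᵐ x ∂σ, sublinearMap G q σ μ v x ≤ v x) {A : ℝ≥0} (hA : 1 ≤ A)
    (h : ∀ᵐ x ∂σ, u x ≤ A * v x) : ∀ᵐ x ∂σ, u x ≤ v x := by
  -- Each application of the map raises the comparison constant to the power `q`.
  have hn : ∀ n : ℕ, ∀ᵐ x ∂σ, u x ≤ (A : ℝ≥0∞) ^ (q ^ n : ℝ) * v x := by
    intro n
    induction n with
    | zero => simpa using h
    | succ n ih =>
      have h1 := sublinearMap_le_of_ae_le_mul (G := G) (μ := μ) hq0 hv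
        (ENNReal.one_le_rpow (by exact_mod_cast hA) (pow_pos hq0 n)) ih
      filter_upwards [hsub, hsup] with x hx hx'
      rw [← ENNReal.rpow_mul, ← pow_succ] at h1
      exact hx.trans ((h1 x).trans (by gcongr))
  have hlim : Filter.Tendsto (fun n : ℕ => (A : ℝ≥0∞) ^ (q ^ n : ℝ)) Filter.atTop (nhds 1) := by
    have hA0 : A ≠ 0 := (one_pos.trans_le hA).ne'
    have hq := tendsto_pow_atTop_nhds_zero_of_lt_one hq0.le hq1
    have h2 : Filter.Tendsto (fun n : ℕ => A ^ (q ^ n : ℝ)) Filter.atTop (nhds (A ^ (0 : ℝ))) :=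
      (NNReal.continuousAt_rpow (Or.inl hA0)).tendsto.comp
        ((tendsto_const_nhds (x := A)).prodMk_nhds hq)
    rw [NNReal.rpow_zero] at h2
    simpa [ENNReal.coe_rpow_of_ne_zero hA0] using ENNReal.tendsto_coe.2 h2
  filter_upwards [ae_all_iff.2 hn] with x hx
  have := ENNReal.Tendsto.mul_const (b := v x) hlim (Or.inl one_ne_zero)
  rw [one_mul] at this
  exact ge_of_tendsto' this hx

end Uniqueness

end SublinearKernel

end

/-! ### Assembly of the theorem -/

theorem theorem1p2 (q : ℝ) (hq0 : 0 < q) (hq1 : q < 1) (κ : ℝ≥0) (hκ : 0 < κ) :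
    ∃ c C : ℝ≥0, 0 < c ∧ 0 < C ∧
      ∀ (Ω : Type*) [TopologicalSpace Ω] [LocallyCompactSpace Ω] [T2Space Ω]
        [SecondCountableTopology Ω] [MeasurableSpace Ω] [BorelSpace Ω]
        (σ μ : Measure Ω) [IsLocallyFiniteMeasure σ] [IsLocallyFiniteMeasure μ]
        (G : Ω → Ω → ℝ≥0∞) (m : Ω → ℝ≥0),
        σ ≠ 0 → IsKernel G → IsQuasiMetricallyModifiable G m κ →
        -- solutions satisfy the bilateral estimates
        (∀ u : Ω → ℝ≥0∞, IsNontrivialSolution G q σ μ u →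
          (∀ᵐ x ∂σ, c * modBound G m q σ x + potential G μ x ≤ u x) ∧
          (∀ᵐ x ∂σ, u x ≤ C * modBound G m q σ x + C * potential G μ x)) ∧
        -- solutions are unique
        (∀ u v : Ω → ℝ≥0∞, IsNontrivialSolution G q σ μ u →
          IsNontrivialSolution G q σ μ v → u =ᵐ[σ] v) ∧
        -- the lower bound for supersolutions
        (∀ u : Ω → ℝ≥0∞, IsNontrivialSupersolution G q σ μ u →
          ∀ᵐ x ∂σ, c * modBound G m q σ x + potential G μ x ≤ u x) ∧
        -- the upper bound for subsolutions
        (∀ u : Ω → ℝ≥0∞, IsSubsolution G q σ μ u →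
          ∀ᵐ x ∂σ, u x ≤ C * modBound G m q σ x + C * potential G μ x) := by
  have hL : lowerConst q κ ≠ ∞ := lowerConst_ne_top hq0 hq1
  have hU : upperConst q κ + 1 ≠ ∞ := ENNReal.add_ne_top.2 ⟨upperConst_ne_top hq0 hq1, by simp⟩
  set L := (lowerConst q κ).toNNReal with hLdef
  set C := (upperConst q κ + 1).toNNReal with hCdef
  have hLc : (L : ℝ≥0∞) = lowerConst q κ := ENNReal.coe_toNNReal hL
  have hCc : (C : ℝ≥0∞) = upperConst q κ + 1 := ENNReal.coe_toNNReal hU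
  have hC1 : 1 ≤ C := by
    rw [← ENNReal.coe_le_coe, hCc]
    exact le_add_self
  -- With `L + 1` in place of `L` the inverse needs no separate positivity argument, and `L + 1 ≥ 1`
  -- also absorbs `Gμ` in the comparison below.
  refine ⟨(L + 1)⁻¹, C, by positivity, one_pos.trans_le hC1, ?_⟩
  intro Ω _ _ _ _ _ _ σ μ _ _ G m _ hG hmod
  have hlower : ∀ u : Ω → ℝ≥0∞, IsNontrivialSupersolution G q σ μ u →
      ∀ᵐ x ∂σ, ((L + 1)⁻¹ : ℝ≥0) * modBound G m q σ x + potential G μ x ≤ u x := by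
    intro u hu
    filter_upwards [hu.le] with x hx
    refine le_trans (add_le_add ?_ le_rfl) hx
    rw [ENNReal.coe_inv (by positivity), ← ENNReal.div_eq_inv_mul]
    refine ENNReal.div_le_of_le_mul' ((hu.modBound_le hq0 hq1 hκ hG hmod x).trans ?_)
    rw [← hLc]
    gcongr
    exact le_self_add
  have hupper : ∀ u : Ω → ℝ≥0∞, IsSubsolution G q σ μ u →
      ∀ᵐ x ∂σ, u x ≤ C * modBound G m q σ x + C * potential G μ x := by
    intro u hu
    simpa only [hCc, mul_add] using hu.le_modBound hq0 hq1 hκ hG hmod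
  -- The upper bound for `u` and the lower bound for `v` share `modBound`, which gives `u ≤ C (L +
  -- 1) v`; iteration removes the constant.
  have hcompare : ∀ u v : Ω → ℝ≥0∞, IsSubsolution G q σ μ u →
      IsNontrivialSupersolution G q σ μ v → ∀ᵐ x ∂σ, u x ≤ v x := by
    intro u v hu hv
    refine ae_le_of_ae_le_mul hq0 hq1 hv.measurable hu.le hv.le
      (one_le_mul hC1 (le_add_self : 1 ≤ L + 1)) ?_
    filter_upwards [hupper u hu, hv.le] with x hx hvx
    calc u x ≤ C * modBound G m q σ x + C * potential G μ x := hx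
      _ ≤ C * (L * potential G (σ.withDensity fun y => v y ^ q) x)
          + C * ((L + 1) * potential G μ x) := by
        gcongr
        · exact (hv.modBound_le hq0 hq1 hκ hG hmod x).trans (by rw [hLc])
        · exact le_mul_of_one_le_left' le_add_self
      _ ≤ C * ((L + 1) * potential G (σ.withDensity fun y => v y ^ q) x)
          + C * ((L + 1) * potential G μ x) := by
        gcongr
        exact le_self_add
      _ = (C * (L + 1) : ℝ≥0) * sublinearMap G q σ μ v x := by
        rw [sublinearMap]
        push_cast
        ring
      _ ≤ (C * (L + 1) : ℝ≥0) * v x := by gcongr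
  refine ⟨fun u hu => ⟨hlower u hu.2, hupper u hu.1⟩, fun u v hu hv => ?_, hlower, hupper⟩
  filter_upwards [hcompare u v hu.1 hv.2, hcompare v u hv.1 hu.2] with x h1 h2
  exact le_antisymm h1 h2
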